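/- Let $n\ge 1$, $0<\alpha<2$, let $G\in C^1(\mathbb R)$ satisfy $G(0)=0$ and $G'(t)\ge c_0>0$ for all $t\in\mathbb R$, and put $$F_\alpha(u)(x)=C_{n,\alpha}\lim_{\varepsilon\to0^+}\int_{\mathbb R^n\setminus B_\varepsilon(x)}\frac{G(u(x)-u(z))}{|x-z|^{n+\alpha}}\,dz ,\qquad C_{n,\alpha}=\frac{\alpha\,2^{\alpha-1}\,\Gamma\!\left(\frac{n+\alpha}{2}\right)}{\pi^{n/2}\,\Gamma\!\left(1-\frac{\alpha}{2}\right)}$$ (so that $F_\alpha=(-\Delta)^{\alpha/2}$ when $G$ is the identity). Let $\mathbb R^n_+=\{x\in\mathbb R^n : x_n>0\}$ and let $L_\alpha$ be the set of $u\in L^1_{loc}(\mathbb R^n)$ with $\int_{\mathbb R^n}\frac{|u(x)|}{1+|x|^{n+\alpha}}\,dx<\infty$. Let $h:\mathbb R\to\mathbb R$, and let $u\in L_\alpha$ be a nonnegative function on $\mathbb R^n$ that is continuous on $\mathbb R^n$ and belongs to $C^{1,1}_{loc}(\mathbb R^n_+)$ (in particular, any nonnegative $u\in L_\alpha\cap C^{1,1}_{loc}(\mathbb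 R^n)$ is allowed). Suppose that $F_\alpha(u)(x)$ exists for every $x\in\mathbb R^n_+$ and $$F_\alpha(u)(x)=h(u(x))\quad\text{for } x\in\mathbb R^n_+,\qquad u(x)=0\quad\text{for } x\notin\mathbb R^n_+ .$$ Suppose further that $\lim_{|x|\to\infty}u(x)=0$, that $h$ is Lipschitz continuous on the range of $u$, and that $h(0)=0$. Then $u(x)=0$ for all $x\in\mathbb R^n$. -/

import Mathlib

open MeasureTheory Filter Topology

namespace HalfSpaceLiouville

/-- The normalizing constant `C_{n,α}` of the fractional Laplacian: with this constant the choice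
`G = id` in the operator below gives `(-Δ)^{α/2}` on `ℝⁿ`. It is positive for `0 < α < 2`. -/
noncomputable def normConst (n : ℕ) (α : ℝ) : ℝ :=
  α * (2 : ℝ) ^ (α - 1) * Real.Gamma (((n : ℝ) + α) / 2) /
    (Real.pi ^ ((n : ℝ) / 2) * Real.Gamma (1 - α / 2))

/-- The truncated integral `C_{n,α} ∫_{ℝⁿ ∖ B_ε(x)} G(u(x) - u(z)) / |x - z|^{n+α} dz`. -/
noncomputable def truncatedF {n : ℕ} (G : ℝ → ℝ) (α : ℝ) (u : EuclideanSpace ℝ (Fin n) → ℝ)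
    (x : EuclideanSpace ℝ (Fin n)) (ε : ℝ) : ℝ :=
  normConst n α *
    ∫ z in (Metric.ball x ε)ᶜ, G (u x - u z) / ‖x - z‖ ^ ((n : ℝ) + α)

/-- `F_α(u)(x)` exists and equals `y`: every truncated integral converges absolutely, and the
truncated integrals tend to `y` as `ε → 0⁺` (Cauchy principal value). -/
def HasFAlpha {n : ℕ} (G : ℝ → ℝ) (α : ℝ) (u : EuclideanSpace ℝ (Fin n) → ℝ)
    (x : EuclideanSpace ℝ (Fin n)) (y : ℝ) : Prop :=
  (∀ ε : ℝ, 0 < ε → IntegrableOn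
      (fun z => G (u x - u z) / ‖x - z‖ ^ ((n : ℝ) + α)) (Metric.ball x ε)ᶜ volume) ∧
    Tendsto (truncatedF G α u x) (𝓝[>] 0) (𝓝 y)

/-- `u ∈ L_α`: `u` is locally integrable on `ℝⁿ` and `∫ |u(x)| / (1 + |x|^{n+α}) dx < ∞`. -/
def MemLAlpha {n : ℕ} (α : ℝ) (u : EuclideanSpace ℝ (Fin n) → ℝ) : Prop :=
  LocallyIntegrable u volume ∧
    Integrable (fun x => |u x| / (1 + ‖x‖ ^ ((n : ℝ) + α))) volume

/-- `u ∈ C^{1,1}_loc(Ω)` for an open set `Ω`: `u` is differentiable in `Ω`, and its derivative is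
locally Lipschitz in `Ω`. -/
def IsC11LocOn {n : ℕ} (u : EuclideanSpace ℝ (Fin n) → ℝ)
    (Ω : Set (EuclideanSpace ℝ (Fin n))) : Prop :=
  DifferentiableOn ℝ u Ω ∧ LocallyLipschitzOn Ω (fderiv ℝ u)

/-- The open upper half space of `ℝ^{m+1}`: the last coordinate is positive. -/
def upperHalfSpace (m : ℕ) : Set (EuclideanSpace ℝ (Fin (m + 1))) :=
  {x | 0 < x (Fin.last m)}

end HalfSpaceLiouville

namespace HalfSpaceLiouville

/-! The proof moves horizontal planes upward in steps of quantified size. Write `y^l` for `reflect l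
y`, `w_l(y) = u(y^l) - u(y)` and `e` for `lastVec m`. The goal is `w_l ≥ 0` below every level `l >
0`; then `u(x) ≤ u(x^l)`, and the right side tends to `0` as `l → ∞`. At `l = 0` the inequality is
trivial, because `u = 0` below the boundary.

Suppose `w_l ≥ 0` holds at level `l` but fails at level `l + η`. By decay, `w_{l+η}` attains a
minimum `-d < 0` below the mirror, at some `x`. Pairing each point with its mirror image in `F_α(u)`
at `x` and at `x^{l+η}`, and using `G' ≥ c₀`, gives `setIntegral_le_of_reflection_min`: integrals of
the kernel-weighted excess of `w_{l+η}` over its minimum are at most a multiple of `h(u(x)) -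
h(u(x^{l+η}))`, hence at most a multiple of `d`. There are three consequences. The point `x` stays a
fixed distance from the mirror (`ReflectionBound.distance`). On a small ball next to `x`, `w_{l+η}`
is on average close to `-d` (`ReflectionBound.near`). On a unit ball lying above the mirror image of
the boundary, `u` has mass `O(d)` (`ReflectionBound.far`).

Two estimates then conflict. By monotonicity at level `l`, `w_{l+η}(y) ≥ u(y - 2ηe) - u(y)`;
integrating this against a Lipschitz tent and moving the translation onto the tent bounds `d` by a
multiple of `η` times the mass of `u` near `x` (`mul_le_of_average_near_min`). A weak Harnack
argument, touching `u` from below by a paraboloid of height `O(d)` in the far ball, shows that this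
mass is itself `O(d)` (`exists_setIntegral_le_of_paraboloid`). So `d ≤ Cηd`, which is impossible for
small `η`. Since `C` is uniform for levels up to `Λ`, finitely many equal steps reach `Λ`.

The Harnack argument needs control of the operator on linear functions. As `G` need not be odd,
their contributions on annuli need not cancel. But if `F_α(u)` exists at one point with nonzero
gradient, the annular integrals for that gradient stay bounded, and rotation and scaling carry the
bound to all bounded gradients (`exists_annulusIntegral_le`). If the gradient vanishes everywhere in
the half space, `u` is constant there and decay gives `u = 0`. -/

/-- The unit vector in the direction of the last coordinate. -/
noncomputable def lastVec (m : ℕ) : EuclideanSpace ℝ (Fin (m + 1)) :=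
  EuclideanSpace.single (Fin.last m) 1

/-- The reflection in the hyperplane where the last coordinate equals `l`. -/
noncomputable def reflect {m : ℕ} (l : ℝ) (y : EuclideanSpace ℝ (Fin (m + 1))) :
    EuclideanSpace ℝ (Fin (m + 1)) :=
  y + (2 * (l - y (Fin.last m))) • lastVec m

/-! ### Reflections in horizontal hyperplanes. -/

section Geometry

variable {m : ℕ}

@[simp] lemma lastVec_last : lastVec m (Fin.last m) = 1 := by simp [lastVec]

@[simp] lemma norm_lastVec : ‖lastVec m‖ = 1 := by simp [lastVec]

lemma inner_lastVec (y : EuclideanSpace ℝ (Fin (m + 1))) :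
    inner ℝ (lastVec m) y = y (Fin.last m) := by
  simp [lastVec, EuclideanSpace.inner_single_left]

@[simp] lemma add_smul_lastVec_last (y : EuclideanSpace ℝ (Fin (m + 1))) (t : ℝ) :
    (y + t • lastVec m) (Fin.last m) = y (Fin.last m) + t := by simp

@[simp] lemma reflect_last (l : ℝ) (y : EuclideanSpace ℝ (Fin (m + 1))) :
    reflect l y (Fin.last m) = 2 * l - y (Fin.last m) := by
  simp only [reflect, add_smul_lastVec_last]; ring

@[simp] lemma reflect_reflect (l : ℝ) (y : EuclideanSpace ℝ (Fin (m + 1))) :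
    reflect l (reflect l y) = y := by
  have h : reflect l (reflect l y)
      = reflect l y + (2 * (l - reflect l y (Fin.last m))) • lastVec m := rfl
  rw [h, reflect_last]
  simp only [reflect]
  module

lemma reflect_eq (l : ℝ) (y : EuclideanSpace ℝ (Fin (m + 1))) :
    reflect l y = Submodule.reflection (Submodule.span ℝ {lastVec m})ᗮ y + (2 * l) • lastVec m := by
  rw [Submodule.reflection_orthogonal_apply, Submodule.reflection_singleton_apply, inner_lastVec]
  simp only [reflect, norm_lastVec]
  simp
  module

lemma isometry_reflect (l : ℝ) : Isometry (reflect (m := m) l) := by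
  have : (reflect (m := m) l) = (fun y => y + (2 * l) • lastVec m) ∘
      (Submodule.reflection (Submodule.span ℝ {lastVec m})ᗮ) := funext (reflect_eq l)
  rw [this]
  exact (isometry_add_right _).comp (LinearIsometryEquiv.isometry _)

lemma norm_reflect_sub_reflect (l : ℝ) (x y : EuclideanSpace ℝ (Fin (m + 1))) :
    ‖reflect l x - reflect l y‖ = ‖x - y‖ := by
  rw [← dist_eq_norm, (isometry_reflect l).dist_eq, dist_eq_norm]

lemma norm_sub_reflect_comm (l : ℝ) (x y : EuclideanSpace ℝ (Fin (m + 1))) :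
    ‖reflect l x - y‖ = ‖x - reflect l y‖ := by
  rw [← norm_reflect_sub_reflect l, reflect_reflect]

lemma continuous_reflect (l : ℝ) : Continuous (reflect (m := m) l) :=
  (isometry_reflect l).continuous

lemma measurePreserving_reflect (l : ℝ) :
    MeasurePreserving (reflect (m := m) l) volume volume := by
  have : (reflect (m := m) l) = (fun y => y + (2 * l) • lastVec m) ∘
      (Submodule.reflection (Submodule.span ℝ {lastVec m})ᗮ) := funext (reflect_eq l)
  rw [this]
  exact (measurePreserving_add_right volume _).comp (LinearIsometryEquiv.measurePreserving _)

lemma measurableEmbedding_reflect (l : ℝ) : MeasurableEmbedding (reflect (m := m) l) :=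
  (isometry_reflect l).isClosedEmbedding.measurableEmbedding

/-- The gap between the two squared distances is a product of heights below the mirror. All
comparisons between the kernel and its reflection rest on this identity. -/
lemma norm_sub_reflect_sq (l : ℝ) (x y : EuclideanSpace ℝ (Fin (m + 1))) :
    ‖x - reflect l y‖ ^ 2
      = ‖x - y‖ ^ 2 + 4 * (l - x (Fin.last m)) * (l - y (Fin.last m)) := by
  have h : x - reflect l y = (x - y) - (2 * (l - y (Fin.last m))) • lastVec m := by
    simp only [reflect]; abel
  rw [h, norm_sub_sq_real, inner_smul_right, real_inner_comm, inner_lastVec, norm_smul,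
    norm_lastVec, Real.norm_eq_abs, mul_one, sq_abs, PiLp.sub_apply]
  ring

lemma norm_sub_le_norm_sub_reflect {l : ℝ} {x y : EuclideanSpace ℝ (Fin (m + 1))}
    (hx : x (Fin.last m) ≤ l) (hy : y (Fin.last m) ≤ l) : ‖x - y‖ ≤ ‖x - reflect l y‖ := by
  have := norm_sub_reflect_sq l x y
  refine le_of_sq_le_sq ?_ (norm_nonneg _)
  nlinarith [mul_nonneg (sub_nonneg.2 hx) (sub_nonneg.2 hy)]

lemma continuous_last : Continuous fun y : EuclideanSpace ℝ (Fin (m + 1)) => y (Fin.last m) := by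
  fun_prop

lemma abs_last_le (y : EuclideanSpace ℝ (Fin (m + 1))) : |y (Fin.last m)| ≤ ‖y‖ :=
  PiLp.norm_apply_le y (Fin.last m)

lemma last_lt_of_mem_ball {x y : EuclideanSpace ℝ (Fin (m + 1))} {r : ℝ}
    (h : y ∈ Metric.ball x r) : |y (Fin.last m) - x (Fin.last m)| < r := by
  have := abs_last_le (y - x)
  rw [Metric.mem_ball, dist_eq_norm] at h
  simpa using this.trans_lt h

lemma reflect_preimage_ball (l : ℝ) (x : EuclideanSpace ℝ (Fin (m + 1))) (r : ℝ) :
    reflect l ⁻¹' (Metric.ball (reflect l x) r) = Metric.ball x r := by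
  ext y
  simp [(isometry_reflect l).dist_eq]

lemma volume_real_ball (x : EuclideanSpace ℝ (Fin (m + 1))) {r : ℝ} (hr : 0 ≤ r) :
    volume.real (Metric.ball x r)
      = r ^ (m + 1) * volume.real (Metric.ball (0 : EuclideanSpace ℝ (Fin (m + 1))) 1) := by
  simp [measureReal_def, Measure.addHaar_ball volume x hr, ENNReal.toReal_ofReal, hr]

lemma volume_real_unitBall_pos :
    0 < volume.real (Metric.ball (0 : EuclideanSpace ℝ (Fin (m + 1))) 1) :=
  ENNReal.toReal_pos (Metric.measure_ball_pos _ _ one_pos).ne' measure_ball_lt_top.ne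

end Geometry

/-! ### Positivity of the constant and integrability of the kernel. -/

lemma normConst_pos (n : ℕ) {α : ℝ} (hα0 : 0 < α) (hα2 : α < 2) : 0 < normConst n α := by
  have h1 : 0 < Real.Gamma (((n : ℝ) + α) / 2) := Real.Gamma_pos_of_pos (by positivity)
  have h2 : 0 < Real.Gamma (1 - α / 2) := Real.Gamma_pos_of_pos (by linarith)
  have := Real.pi_pos
  unfold normConst
  positivity

section Kernel

variable {m : ℕ} {α : ℝ}

lemma integrableOn_kernel_compl_ball (hα0 : 0 < α) (x : EuclideanSpace ℝ (Fin (m + 1))) {r : ℝ}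
    (hr : 0 < r) :
    IntegrableOn (fun z => 1 / ‖x - z‖ ^ (((m + 1 : ℕ) : ℝ) + α)) (Metric.ball x r)ᶜ := by
  set p : ℝ := ((m + 1 : ℕ) : ℝ) + α with hp
  have hp0 : 0 < p := by positivity
  have h1 : Integrable (fun z : EuclideanSpace ℝ (Fin (m + 1)) => (1 + ‖z‖) ^ (-p)) volume :=
    integrable_one_add_norm (by rw [finrank_euclideanSpace_fin]; linarith)
  have h2 := ((h1.comp_sub_left x).const_mul ((1 + 1 / r) ^ p)).integrableOn
    (s := (Metric.ball x r)ᶜ)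
  refine h2.mono' (Measurable.aestronglyMeasurable (by fun_prop)) ?_
  refine (ae_restrict_mem measurableSet_ball.compl).mono fun z hz => ?_
  have hz' : r ≤ ‖x - z‖ := by
    simpa [dist_eq_norm, norm_sub_rev] using hz
  have hpos : 0 < ‖x - z‖ := hr.trans_le hz'
  rw [Real.norm_of_nonneg (by positivity), Real.rpow_neg (by positivity), ← div_eq_mul_inv,
    div_le_div_iff₀ (by positivity) (by positivity), one_mul,
    ← Real.mul_rpow (by positivity) (by positivity)]
  refine Real.rpow_le_rpow (by positivity) ?_ hp0.le
  have : 1 ≤ 1 / r * ‖x - z‖ := by rw [one_div, ← div_eq_inv_mul, one_le_div hr]; exact hz'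
  linarith

/-- The power `k - n - α` exceeds `-n` exactly when `α < k`. It serves with `k = 2` for Taylor
remainders and with `k = 1` for linear terms when `α < 1`. -/
lemma integrableOn_ball_pow_mul_kernel (k : ℕ) (hk : α < k) (r : ℝ) :
    IntegrableOn (fun z : EuclideanSpace ℝ (Fin (m + 1)) =>
      ‖z‖ ^ k / ‖z‖ ^ (((m + 1 : ℕ) : ℝ) + α)) (Metric.ball 0 r) := by
  refine integrableOn_ball_of_norm_le_rpow (C := 1) (α := ((m + 1 : ℕ) : ℝ) + α - k) (by simp)
    (by rw [finrank_euclideanSpace_fin]; linarith) ?_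
    (Measurable.aestronglyMeasurable (by fun_prop))
  have : ∀ᵐ z : EuclideanSpace ℝ (Fin (m + 1)), z ≠ 0 := by
    simp [ae_iff]
  refine ae_restrict_of_ae (this.mono fun z hz => ?_)
  have hz0 : 0 < ‖z‖ := norm_pos_iff.2 hz
  rw [Real.norm_of_nonneg (by positivity), one_mul, neg_sub, Real.rpow_sub hz0, Real.rpow_natCast]

end Kernel

/-! ### Folding integrals over the mirror, and comparison at a minimum of the increment. -/

lemma measurableSet_last_lt {m : ℕ} (l : ℝ) :
    MeasurableSet {y : EuclideanSpace ℝ (Fin (m + 1)) | y (Fin.last m) < l} :=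
  (isOpen_lt continuous_last continuous_const).measurableSet

lemma volume_last_eq {m : ℕ} (l : ℝ) :
    volume {y : EuclideanSpace ℝ (Fin (m + 1)) | y (Fin.last m) = l} = 0 := by
  have h := (EuclideanSpace.volume_preserving_symm_measurableEquiv_toLp (Fin (m + 1))).measure_preimage_equiv
    {y : Fin (m + 1) → ℝ | y (Fin.last m) = l}
  have h2 : volume {y : Fin (m + 1) → ℝ | y (Fin.last m) = l} = 0 := by
    rw [volume_pi]
    exact Measure.pi_hyperplane (α := fun _ => ℝ) (fun _ => volume) (Fin.last m) l
  rw [h2] at h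
  exact h

lemma setIntegral_last_ge {m : ℕ} (l : ℝ) (f : EuclideanSpace ℝ (Fin (m + 1)) → ℝ) :
    ∫ y in {y | y (Fin.last m) < l}ᶜ, f y
      = ∫ y in {y | y (Fin.last m) < l}, f (reflect l y) := by
  rw [← (measurePreserving_reflect l).setIntegral_preimage_emb (measurableEmbedding_reflect l)]
  refine setIntegral_congr_set ?_
  rw [ae_eq_set]
  refine ⟨measure_mono_null ?_ (volume_last_eq (m := m) l), measure_mono_null ?_ (measure_empty)⟩
  · intro y hy
    simp only [Set.mem_sdiff, Set.mem_preimage, Set.mem_compl_iff, Set.mem_ofPred_eq, reflect_last,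
      not_lt] at hy ⊢
    linarith [hy.1, hy.2]
  · intro y hy
    simp only [Set.mem_sdiff, Set.mem_preimage, Set.mem_compl_iff, Set.mem_ofPred_eq, reflect_last,
      not_lt] at hy ⊢
    linarith [hy.1, hy.2]

lemma integrableOn_last_ge {m : ℕ} {l : ℝ} {f : EuclideanSpace ℝ (Fin (m + 1)) → ℝ}
    (hf : IntegrableOn f {y | y (Fin.last m) < l}ᶜ) :
    IntegrableOn (fun y => f (reflect l y)) {y | y (Fin.last m) < l} := by
  rw [← (measurePreserving_reflect l).integrableOn_comp_preimage
    (measurableEmbedding_reflect l)] at hf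
  refine hf.mono_set fun y hy => ?_
  simp only [Set.mem_preimage, Set.mem_compl_iff, Set.mem_ofPred_eq, reflect_last, not_lt] at hy ⊢
  linarith

lemma HasFAlpha.tendsto_integral {n : ℕ} {G : ℝ → ℝ} {α : ℝ}
    {u : EuclideanSpace ℝ (Fin n) → ℝ} {x : EuclideanSpace ℝ (Fin n)} {y : ℝ}
    (hα0 : 0 < α) (hα2 : α < 2) (h : HasFAlpha G α u x y) :
    Tendsto (fun ε => ∫ z in (Metric.ball x ε)ᶜ, G (u x - u z) / ‖x - z‖ ^ ((n : ℝ) + α))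
      (𝓝[>] 0) (𝓝 (y / normConst n α)) := by
  have hC := normConst_pos n hα0 hα2
  refine (h.2.div_const (normConst n α)).congr fun ε => ?_
  rw [truncatedF, mul_div_cancel_left₀ _ hC.ne']

/-- Pointwise form of the comparison at a minimum of `u ∘ reflect l - u`: the left-hand side is
what two reflected points contribute to `F_α(u)(reflect l x) - F_α(u)(x)`. -/
lemma reflected_increment_le {G : ℝ → ℝ} {c₀ : ℝ}
    (hGm : ∀ s t, s ≤ t → c₀ * (t - s) ≤ G t - G s)
    {a a' b b' k k' : ℝ} (hk' : 0 ≤ k') (hkk : k' ≤ k) (haa : a' ≤ a) (hab : a' - a ≤ b' - b) :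
    (G (a' - b') - G (a - b)) * k + (G (a' - b) - G (a - b')) * k'
      ≤ -(c₀ * ((b' - b) - (a' - a)) * (k - k') + 2 * c₀ * (-(a' - a)) * k') := by
  -- With `A` and `D` the two differences of `G`, the left side is `A(k - k') + (A + D)k'`. The sum
  -- `A + D` is regrouped as `[G(a'-b) - G(a-b)] + [G(a'-b') - G(a-b')]`, where the arguments in
  -- each bracket differ by `a' - a`.
  have h1 := hGm (a' - b') (a - b) (by linarith)
  have h2 := hGm (a' - b) (a - b) (by linarith)
  have h3 := hGm (a' - b') (a - b') (by linarith)
  have e1 := mul_le_mul_of_nonneg_right h1 (sub_nonneg.2 hkk)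
  have e2 := mul_le_mul_of_nonneg_right (add_le_add h2 h3) hk'
  linarith

/-- Comparison of `F_α(u)` at a point `x` and at its mirror image, where `x` is a point of
nonpositive minimum of `u ∘ reflect l - u` on the half space below the mirror. -/
lemma setIntegral_le_of_reflection_min {m : ℕ} {G : ℝ → ℝ} {α c₀ : ℝ} (hα0 : 0 < α) (hα2 : α < 2)
    (hc₀ : 0 < c₀) (hGm : ∀ s t, s ≤ t → c₀ * (t - s) ≤ G t - G s)
    {u : EuclideanSpace ℝ (Fin (m + 1)) → ℝ}
    {l a b : ℝ} {x : EuclideanSpace ℝ (Fin (m + 1))} (hx : x (Fin.last m) < l)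
    (ha : HasFAlpha G α u x a) (hb : HasFAlpha G α u (reflect l x) b)
    (hmin : ∀ y : EuclideanSpace ℝ (Fin (m + 1)), y (Fin.last m) < l →
      u (reflect l x) - u x ≤ u (reflect l y) - u y)
    (hneg : u (reflect l x) ≤ u x)
    {S : Set (EuclideanSpace ℝ (Fin (m + 1)))} (hS : MeasurableSet S)
    (hSl : ∀ y ∈ S, y (Fin.last m) < l) {r : ℝ} (hr : 0 < r) (hSr : ∀ y ∈ S, r ≤ ‖x - y‖)
    {g : EuclideanSpace ℝ (Fin (m + 1)) → ℝ} (hg : IntegrableOn g S)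
    (hgle : ∀ y ∈ S, g y ≤ c₀ * ((u (reflect l y) - u y) - (u (reflect l x) - u x)) *
        (1 / ‖x - y‖ ^ (((m + 1 : ℕ) : ℝ) + α)
          - 1 / ‖x - reflect l y‖ ^ (((m + 1 : ℕ) : ℝ) + α)) +
      2 * c₀ * (-(u (reflect l x) - u x)) * (1 / ‖x - reflect l y‖ ^ (((m + 1 : ℕ) : ℝ) + α))) :
    ∫ y in S, g y ≤ (a - b) / normConst (m + 1) α := by
  set p : ℝ := ((m + 1 : ℕ) : ℝ) + α with hp
  have hp0 : 0 < p := by positivity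
  set H : Set (EuclideanSpace ℝ (Fin (m + 1))) := {y | y (Fin.last m) < l} with hH
  have hHm : MeasurableSet H := measurableSet_last_lt l
  set P : EuclideanSpace ℝ (Fin (m + 1)) → ℝ := fun y =>
    G (u (reflect l x) - u (reflect l y)) / ‖reflect l x - reflect l y‖ ^ p
      - G (u x - u y) / ‖x - y‖ ^ p with hP
  -- integrability of both contributions
  have hIR : ∀ ε, 0 < ε → IntegrableOn (fun y =>
      G (u (reflect l x) - u (reflect l y)) / ‖reflect l x - reflect l y‖ ^ p)
      (Metric.ball x ε)ᶜ := fun ε hε => by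
    have := hb.1 ε hε
    rw [← (measurePreserving_reflect l).integrableOn_comp_preimage
      (measurableEmbedding_reflect l), Set.preimage_compl, reflect_preimage_ball] at this
    exact this
  have hIP : ∀ ε, 0 < ε → IntegrableOn P (Metric.ball x ε)ᶜ := fun ε hε =>
    (hIR ε hε).sub (ha.1 ε hε)
  have hball : ∀ ε, ε ≤ l - x (Fin.last m) → Metric.ball x ε ⊆ H := fun ε hε y hy => by
    have := (abs_lt.1 (last_lt_of_mem_ball hy)).2
    simp only [hH, Set.mem_ofPred_eq]; linarith
  have hδ : 0 < l - x (Fin.last m) := by linarith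
  have hIPR : IntegrableOn (fun y => P (reflect l y)) H :=
    integrableOn_last_ge ((hIP _ hδ).mono_set (Set.compl_subset_compl.2 (hball _ le_rfl)))
  -- pointwise bound
  have hQ : ∀ y ∈ H, P y + P (reflect l y) ≤
      -(c₀ * ((u (reflect l y) - u y) - (u (reflect l x) - u x)) *
        (1 / ‖x - y‖ ^ p - 1 / ‖x - reflect l y‖ ^ p) +
      2 * c₀ * (-(u (reflect l x) - u x)) * (1 / ‖x - reflect l y‖ ^ p)) ∨ y = x := by
    intro y hy
    -- At `y = x` the convention `1 / 0 = 0` destroys the ordering of the two kernels, so this point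
    -- is set aside.
    by_cases hyx : y = x
    · exact Or.inr hyx
    left
    have hpos : 0 < ‖x - y‖ := norm_pos_iff.2 (sub_ne_zero.2 (Ne.symm hyx))
    have hle : ‖x - y‖ ≤ ‖x - reflect l y‖ :=
      norm_sub_le_norm_sub_reflect hx.le (le_of_lt hy)
    have hkk : 1 / ‖x - reflect l y‖ ^ p ≤ 1 / ‖x - y‖ ^ p :=
      one_div_le_one_div_of_le (by positivity) (Real.rpow_le_rpow hpos.le hle hp0.le)
    have := reflected_increment_le hGm (by positivity) hkk hneg (hmin y hy)
    refine le_trans (le_of_eq ?_) this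
    simp only [hP, reflect_reflect, norm_sub_reflect_comm]
    ring
  have hq0 : ∀ y ∈ H, y ≠ x → 0 ≤ c₀ * ((u (reflect l y) - u y) - (u (reflect l x) - u x)) *
        (1 / ‖x - y‖ ^ p - 1 / ‖x - reflect l y‖ ^ p) +
      2 * c₀ * (-(u (reflect l x) - u x)) * (1 / ‖x - reflect l y‖ ^ p) := by
    intro y hy hyx
    have hpos : 0 < ‖x - y‖ := norm_pos_iff.2 (sub_ne_zero.2 (Ne.symm hyx))
    have hle : ‖x - y‖ ≤ ‖x - reflect l y‖ :=
      norm_sub_le_norm_sub_reflect hx.le (le_of_lt hy)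
    have hkk : 1 / ‖x - reflect l y‖ ^ p ≤ 1 / ‖x - y‖ ^ p :=
      one_div_le_one_div_of_le (by positivity) (Real.rpow_le_rpow hpos.le hle hp0.le)
    have h1 := sub_nonneg.2 (hmin y hy)
    have h2 := sub_nonneg.2 hkk
    have h3 : 0 ≤ -(u (reflect l x) - u x) := by linarith
    positivity
  -- inequality for a fixed truncation radius
  have key : ∀ ε, 0 < ε → ε ≤ r → ε ≤ l - x (Fin.last m) →
      ∫ y in S, g y ≤ (∫ y in Metric.ball x ε, P (reflect l y) ∂(volume.restrict H))
        - ((∫ z in (Metric.ball (reflect l x) ε)ᶜ, G (u (reflect l x) - u z) / ‖reflect l x - z‖ ^ p)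
        - ∫ z in (Metric.ball x ε)ᶜ, G (u x - u z) / ‖x - z‖ ^ p) := by
    intro ε hε hεr hεl
    have hBH := hball ε hεl
    have e1 : (∫ z in (Metric.ball (reflect l x) ε)ᶜ,
        G (u (reflect l x) - u z) / ‖reflect l x - z‖ ^ p)
        - ∫ z in (Metric.ball x ε)ᶜ, G (u x - u z) / ‖x - z‖ ^ p
        = ∫ y in (Metric.ball x ε)ᶜ, P y := by
      rw [← (measurePreserving_reflect l).setIntegral_preimage_emb (measurableEmbedding_reflect l),
        Set.preimage_compl, reflect_preimage_ball]
      exact (integral_sub (hIR ε hε) (ha.1 ε hε)).symm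
    have hun : (Metric.ball x ε)ᶜ = (H \ Metric.ball x ε) ∪ Hᶜ := by
      ext y
      have := @hBH y
      simp only [Set.mem_compl_iff, Set.mem_union, Set.mem_sdiff]
      tauto
    have hun2 : H = (H \ Metric.ball x ε) ∪ Metric.ball x ε := (Set.sdiff_union_of_subset hBH).symm
    have hI1 : IntegrableOn P (H \ Metric.ball x ε) :=
      (hIP ε hε).mono_set (fun y hy => hy.2)
    have hI2 : IntegrableOn (fun y => P (reflect l y)) (H \ Metric.ball x ε) :=
      hIPR.mono_set Set.sdiff_subset
    have e2 : ∫ y in (Metric.ball x ε)ᶜ, P y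
        = (∫ y in H \ Metric.ball x ε, P y) + ∫ y in Hᶜ, P y := by
      rw [hun]
      exact setIntegral_union (Set.disjoint_compl_right_iff_subset.2 Set.sdiff_subset) hHm.compl hI1
        ((hIP ε hε).mono_set (Set.compl_subset_compl.2 hBH))
    -- The upper half is folded onto `H`. The mirror image of the removed ball has no partner and is
    -- kept as a separate term, which vanishes as `ε → 0`.
    have e3 : ∫ y in Hᶜ, P y = (∫ y in H \ Metric.ball x ε, P (reflect l y))
        + ∫ y in Metric.ball x ε, P (reflect l y) := by
      rw [setIntegral_last_ge, ← hH]
      conv_lhs => rw [hun2]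
      exact setIntegral_union Set.disjoint_sdiff_left measurableSet_ball hI2 (hIPR.mono_set hBH)
    have e4 : ∫ y in Metric.ball x ε, P (reflect l y) ∂(volume.restrict H)
        = ∫ y in Metric.ball x ε, P (reflect l y) := by
      rw [Measure.restrict_restrict measurableSet_ball, Set.inter_eq_self_of_subset_left hBH]
    have hSsub : S ⊆ H \ Metric.ball x ε := fun y hy => ⟨hSl y hy, fun h => by
      have := hSr y hy
      rw [Metric.mem_ball, dist_eq_norm, norm_sub_rev] at h
      linarith⟩
    have hne : ∀ y ∈ H \ Metric.ball x ε, y ≠ x := fun y hy h => hy.2 (h ▸ Metric.mem_ball_self hε)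
    have hI3 : IntegrableOn (fun y => -(P y + P (reflect l y))) (H \ Metric.ball x ε) :=
      (hI1.add hI2).neg
    have e5 : ∫ y in S, g y ≤ ∫ y in S, -(P y + P (reflect l y)) := by
      refine setIntegral_mono_on hg (hI3.mono_set hSsub) hS fun y hy => ?_
      have h1 := (hQ y (hSl y hy)).resolve_right (hne y (hSsub hy))
      have h2 := hgle y hy
      linarith
    have e6 : ∫ y in S, -(P y + P (reflect l y)) ≤
        ∫ y in H \ Metric.ball x ε, -(P y + P (reflect l y)) := by
      refine setIntegral_mono_set hI3 ?_ (LE.le.eventuallyLE hSsub)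
      refine (ae_restrict_mem (hHm.diff measurableSet_ball)).mono fun y hy => ?_
      have h1 := (hQ y hy.1).resolve_right (hne y hy)
      have h2 := hq0 y hy.1 (hne y hy)
      simp only [Pi.zero_apply]
      linarith
    have e7 : ∫ y in H \ Metric.ball x ε, -(P y + P (reflect l y)) =
        -((∫ y in H \ Metric.ball x ε, P y) + ∫ y in H \ Metric.ball x ε, P (reflect l y)) := by
      rw [integral_neg, integral_add hI1 hI2]
    rw [e1, e2, e3, e4]
    linarith
  -- pass to the limit
  have hvol : Tendsto (fun ε => (volume.restrict H) (Metric.ball x ε)) (𝓝[>] 0) (𝓝 0) := by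
    have h0 : Tendsto (fun ε : ℝ => ENNReal.ofReal (ε ^ (m + 1)) *
        volume (Metric.ball (0 : EuclideanSpace ℝ (Fin (m + 1))) 1)) (𝓝[>] 0) (𝓝 0) := by
      have h1 : Tendsto (fun ε : ℝ => ENNReal.ofReal (ε ^ (m + 1))) (𝓝[>] 0) (𝓝 0) := by
        have : Tendsto (fun ε : ℝ => ε ^ (m + 1)) (𝓝[>] 0) (𝓝 (0 ^ (m + 1))) :=
          ((continuous_pow (m + 1)).tendsto 0).mono_left nhdsWithin_le_nhds
        simpa using ENNReal.tendsto_ofReal this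
      simpa using ENNReal.Tendsto.mul_const h1 (Or.inr measure_ball_lt_top.ne)
    refine tendsto_of_tendsto_of_tendsto_of_le_of_le' tendsto_const_nhds h0
      (Eventually.of_forall fun _ => zero_le) ?_
    filter_upwards [self_mem_nhdsWithin] with ε hε
    refine (Measure.restrict_apply_le _ _).trans (le_of_eq ?_)
    rw [Measure.addHaar_ball volume x (le_of_lt hε), finrank_euclideanSpace_fin]
  have hlim := (hIPR.tendsto_setIntegral_nhds_zero hvol).sub
    ((hb.tendsto_integral hα0 hα2).sub (ha.tendsto_integral hα0 hα2))
  have hfin := ge_of_tendsto hlim (b := ∫ y in S, g y) (by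
    filter_upwards [self_mem_nhdsWithin, mem_nhdsWithin_of_mem_nhds (Iio_mem_nhds hr),
      mem_nhdsWithin_of_mem_nhds (Iio_mem_nhds hδ)] with ε h1 h2 h3
    exact key ε h1 (le_of_lt h2) (le_of_lt h3))
  refine hfin.trans (le_of_eq ?_)
  ring

/-! ### The truncated operator on linear functions. -/

/-- The contribution of a linear function with gradient `v` to the operator on an annulus. -/
noncomputable def annulusIntegral {n : ℕ} (G : ℝ → ℝ) (α ε r : ℝ) (v : EuclideanSpace ℝ (Fin n)) :
    ℝ :=
  ∫ z in Metric.ball 0 r \ Metric.ball 0 ε, G (inner ℝ v z) / ‖z‖ ^ ((n : ℝ) + α)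

/-- `G` is Lipschitz on every bounded interval. -/
def LipschitzOnBounded (G : ℝ → ℝ) : Prop :=
  ∀ M : ℝ, ∃ C : ℝ, 0 < C ∧ ∀ s t : ℝ, |s| ≤ M → |t| ≤ M → |G s - G t| ≤ C * |s - t|

lemma lipschitzOnBounded_of_contDiff {G : ℝ → ℝ} (hG : ContDiff ℝ 1 G) : LipschitzOnBounded G := by
  intro M
  obtain ⟨C, hC⟩ := (isCompact_Icc (a := -M) (b := M)).exists_bound_of_continuousOn
    (hG.continuous_deriv le_rfl).continuousOn
  refine ⟨max C 1, by positivity, fun s t hs ht => ?_⟩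
  have := (convex_Icc (-M) M).norm_image_sub_le_of_norm_deriv_le
    (fun x _ => (hG.differentiable one_ne_zero) x)
    (fun x hx => (hC x hx).trans (le_max_left C 1)) (abs_le.1 ht) (abs_le.1 hs)
  simpa using this

section Annulus

variable {n : ℕ} {G : ℝ → ℝ} {α : ℝ}

lemma integrableOn_annulus {f : EuclideanSpace ℝ (Fin n) → ℝ} (hf : Continuous f) {ε : ℝ}
    (hε : 0 < ε) (r p : ℝ) :
    IntegrableOn (fun z => f z / ‖z‖ ^ p) (Metric.ball 0 r \ Metric.ball 0 ε) := by
  have hc : IsCompact (Metric.closedBall (0 : EuclideanSpace ℝ (Fin n)) r \ Metric.ball 0 ε) :=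
    (isCompact_closedBall _ _).diff Metric.isOpen_ball
  refine (ContinuousOn.integrableOn_compact hc ?_).mono_set
    (Set.sdiff_subset_sdiff_left Metric.ball_subset_closedBall)
  have hpos : ∀ z ∈ Metric.closedBall (0 : EuclideanSpace ℝ (Fin n)) r \ Metric.ball 0 ε,
      0 < ‖z‖ := fun z hz => by
    have := hz.2
    simp only [Metric.mem_ball, dist_zero_right, not_lt] at this
    linarith
  refine hf.continuousOn.div (continuous_norm.continuousOn.rpow_const fun z hz =>
    Or.inl (hpos z hz).ne') fun z hz => (Real.rpow_pos_of_pos (hpos z hz) _).ne'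

lemma annulusIntegral_map (T : EuclideanSpace ℝ (Fin n) ≃ₗᵢ[ℝ] EuclideanSpace ℝ (Fin n))
    (ε r : ℝ) (v : EuclideanSpace ℝ (Fin n)) :
    annulusIntegral G α ε r (T v) = annulusIntegral G α ε r v := by
  unfold annulusIntegral
  rw [← T.measurePreserving.setIntegral_preimage_emb
    T.toHomeomorph.isClosedEmbedding.measurableEmbedding]
  have h : T ⁻¹' (Metric.ball 0 r \ Metric.ball 0 ε) = Metric.ball 0 r \ Metric.ball 0 ε := by
    ext z; simp
  rw [h]
  simp

/-- The annulus and the kernel are invariant under isometries fixing the origin, and the reflection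
exchanging two vectors of equal norm is one of these. -/
lemma annulusIntegral_congr_norm (ε r : ℝ) {v w : EuclideanSpace ℝ (Fin n)} (h : ‖v‖ = ‖w‖) :
    annulusIntegral G α ε r v = annulusIntegral G α ε r w := by
  rw [← annulusIntegral_map (Submodule.reflection (Submodule.span ℝ {v - w})ᗮ) ε r v,
    Submodule.reflection_sub h]

open scoped Pointwise in
-- The substitution `z ↦ tz` moves the factor from the gradient to the radii; the kernel,
-- homogeneous of degree `-(n + α)`, leaves `t ^ α`.
lemma annulusIntegral_smul (ε r : ℝ) {t : ℝ} (ht : 0 < t) (v : EuclideanSpace ℝ (Fin n)) :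
    annulusIntegral G α ε r (t • v) = t ^ α * annulusIntegral G α (t * ε) (t * r) v := by
  unfold annulusIntegral
  have hs : t • (Metric.ball (0 : EuclideanSpace ℝ (Fin n)) r \ Metric.ball 0 ε)
      = Metric.ball 0 (t * r) \ Metric.ball 0 (t * ε) := by
    rw [Set.smul_set_sdiff₀ ht.ne', smul_ball ht.ne', smul_ball ht.ne']
    simp [abs_of_pos ht]
  have h := Measure.setIntegral_comp_smul_of_pos volume
    (fun z : EuclideanSpace ℝ (Fin n) => G (inner ℝ v z) / ‖z‖ ^ ((n : ℝ) + α))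
    (Metric.ball 0 r \ Metric.ball 0 ε) ht
  rw [hs, finrank_euclideanSpace_fin, smul_eq_mul] at h
  have h2 : (∫ z in Metric.ball 0 (t * r) \ Metric.ball 0 (t * ε),
      G (inner ℝ v z) / ‖z‖ ^ ((n : ℝ) + α)) = t ^ n * ∫ z in Metric.ball 0 r \ Metric.ball 0 ε,
        G (inner ℝ v (t • z)) / ‖t • z‖ ^ ((n : ℝ) + α) := by
    rw [h]
    field_simp
  rw [h2, ← integral_const_mul, ← integral_const_mul]
  congr 1
  ext z
  rw [inner_smul_right, inner_smul_left, norm_smul, Real.norm_of_nonneg ht.le,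
    Real.mul_rpow ht.le (norm_nonneg _), Real.rpow_add ht, Real.rpow_natCast]
  simp only [conj_trivial]
  have := Real.rpow_pos_of_pos ht α
  field_simp

lemma annulusIntegral_add (hG : Continuous G) {ε t r : ℝ} (hε : 0 < ε) (h1 : ε ≤ t) (h2 : t ≤ r)
    (v : EuclideanSpace ℝ (Fin n)) :
    annulusIntegral G α ε r v = annulusIntegral G α ε t v + annulusIntegral G α t r v := by
  unfold annulusIntegral
  have hc : Continuous fun z : EuclideanSpace ℝ (Fin n) => G (inner ℝ v z) := by fun_prop
  rw [← setIntegral_union _ (measurableSet_ball.diff measurableSet_ball)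
    (integrableOn_annulus hc hε t _) (integrableOn_annulus hc (hε.trans_le h1) r _)]
  · congr 2
    ext z
    simp only [Set.mem_sdiff, Metric.mem_ball, dist_zero_right, Set.mem_union, not_lt]
    constructor
    · rintro ⟨h3, h4⟩
      by_cases h5 : ‖z‖ < t
      · exact Or.inl ⟨h5, h4⟩
      · exact Or.inr ⟨h3, not_lt.1 h5⟩
    · rintro (⟨h3, h4⟩ | ⟨h3, h4⟩)
      · exact ⟨h3.trans_le h2, h4⟩
      · exact ⟨h3, h1.trans h4⟩
  · rw [Set.disjoint_left]
    exact fun z hz hz' => hz'.2 hz.1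

end Annulus

lemma sdiff_ball_integral_eq {n : ℕ} {f : EuclideanSpace ℝ (Fin n) → ℝ}
    (x : EuclideanSpace ℝ (Fin n)) (ε r : ℝ) :
    ∫ z in Metric.ball x r \ Metric.ball x ε, f z
      = ∫ z in Metric.ball 0 r \ Metric.ball 0 ε, f (x + z) := by
  rw [← (measurePreserving_add_left volume x).setIntegral_preimage_emb
    (measurableEmbedding_addLeft x)]
  congr 2
  ext z
  simp

lemma compl_ball_integral_sub {n : ℕ} {f : EuclideanSpace ℝ (Fin n) → ℝ}
    {x : EuclideanSpace ℝ (Fin n)} {ε r : ℝ} (hεr : ε ≤ r)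
    (hf : IntegrableOn f (Metric.ball x ε)ᶜ) :
    ∫ z in (Metric.ball x ε)ᶜ, f z
      = (∫ z in Metric.ball x r \ Metric.ball x ε, f z) + ∫ z in (Metric.ball x r)ᶜ, f z := by
  have hsub : Metric.ball x ε ⊆ Metric.ball x r := Metric.ball_subset_ball hεr
  rw [← setIntegral_union _ measurableSet_ball.compl (hf.mono_set fun z hz => hz.2)
    (hf.mono_set (Set.compl_subset_compl.2 hsub))]
  · congr 2
    ext z
    have := @hsub z
    simp only [Set.mem_compl_iff, Set.mem_union, Set.mem_sdiff]
    tauto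
  · rw [Set.disjoint_left]
    exact fun z hz hz' => hz' hz.1

/-- If `F_α(u)` exists at a point where `u` has a second order Taylor bound with gradient `v`, then
the truncated operator applied to the linear part stays bounded. -/
lemma annulusIntegral_bounded {m : ℕ} {G : ℝ → ℝ} {α : ℝ} (hα0 : 0 < α) (hα2 : α < 2)
    (hG : Continuous G) (hGL : LipschitzOnBounded G)
    {u : EuclideanSpace ℝ (Fin (m + 1)) → ℝ} (hu : Continuous u) {M : ℝ} (hM : ∀ x, |u x| ≤ M)
    {x v : EuclideanSpace ℝ (Fin (m + 1))} {y L r₁ : ℝ} (hr₁ : 0 < r₁) (hx : HasFAlpha G α u x y)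
    (hT : ∀ z ∈ Metric.ball (0 : EuclideanSpace ℝ (Fin (m + 1))) r₁,
      |inner ℝ v z - (u x - u (x + z))| ≤ L * ‖z‖ ^ 2) :
    ∃ r C : ℝ, 0 < r ∧ ∀ ε, 0 < ε → ε ≤ r → |annulusIntegral G α ε r v| ≤ C := by
  set p : ℝ := ((m + 1 : ℕ) : ℝ) + α with hp
  set T : ℝ → ℝ := fun ε => ∫ z in (Metric.ball x ε)ᶜ, G (u x - u z) / ‖x - z‖ ^ p with hTdef
  have hlim := hx.tendsto_integral hα0 hα2
  have hev := (Metric.tendsto_nhds.1 hlim) 1 one_pos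
  obtain ⟨r₀, hr₀, hball⟩ := mem_nhdsGT_iff_exists_Ioo_subset.1 hev
  -- Below `r₀` truncated integrals are within `1` of their limit, so any two differ by at most `2`;
  -- below `r₁` the Taylor bound holds; `r ≤ 1` keeps the linear part at most `‖v‖`.
  set r := min (r₀ / 2) (min r₁ 1) with hr
  have hr₀' : 0 < r₀ := hr₀
  have hr0 : 0 < r := by positivity
  have hrr₀ : r < r₀ := lt_of_le_of_lt (min_le_left _ _) (by linarith)
  have hrr₁ : r ≤ r₁ := (min_le_right _ _).trans (min_le_left _ _)
  have hr1 : r ≤ 1 := (min_le_right _ _).trans (min_le_right _ _)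
  obtain ⟨C₁, hC₁, hC₁'⟩ := hGL (max (2 * M) ‖v‖)
  refine ⟨r, 2 + C₁ * L * ∫ z in Metric.ball (0 : EuclideanSpace ℝ (Fin (m + 1))) r,
    ‖z‖ ^ 2 / ‖z‖ ^ p, hr0, fun ε hε hεr => ?_⟩
  have hTT : |T ε - T r| ≤ 2 := by
    have h1 : |T ε - y / normConst (m + 1) α| < 1 := hball ⟨hε, hεr.trans_lt hrr₀⟩
    have h2 : |T r - y / normConst (m + 1) α| < 1 := hball ⟨hr0, hrr₀⟩
    rw [abs_lt] at h1 h2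
    rw [abs_le]
    constructor <;> linarith
  have hTsub : T ε - T r = ∫ z in Metric.ball 0 r \ Metric.ball 0 ε,
      G (u x - u (x + z)) / ‖z‖ ^ p := by
    simp only [hTdef]
    rw [compl_ball_integral_sub hεr (hx.1 ε hε), add_sub_cancel_right, sdiff_ball_integral_eq]
    simp only [sub_add_cancel_left, norm_neg, ← hp]
  have hI1 : IntegrableOn (fun z : EuclideanSpace ℝ (Fin (m + 1)) =>
      G (u x - u (x + z)) / ‖z‖ ^ p) (Metric.ball 0 r \ Metric.ball 0 ε) :=
    integrableOn_annulus (f := fun z => G (u x - u (x + z))) (by fun_prop) hε r p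
  have hI2 : IntegrableOn (fun z : EuclideanSpace ℝ (Fin (m + 1)) =>
      G (inner ℝ v z) / ‖z‖ ^ p) (Metric.ball 0 r \ Metric.ball 0 ε) :=
    integrableOn_annulus (f := fun z => G (inner ℝ v z)) (by fun_prop) hε r p
  have hI3 : IntegrableOn (fun z : EuclideanSpace ℝ (Fin (m + 1)) =>
      ‖z‖ ^ 2 / ‖z‖ ^ p) (Metric.ball 0 r) :=
    integrableOn_ball_pow_mul_kernel 2 (by exact_mod_cast hα2) r
  have hL : 0 ≤ L * ∫ z in Metric.ball (0 : EuclideanSpace ℝ (Fin (m + 1))) r,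
      ‖z‖ ^ 2 / ‖z‖ ^ p := by
    rw [← integral_const_mul]
    refine setIntegral_nonneg measurableSet_ball fun z hz => ?_
    rw [← mul_div_assoc]
    exact div_nonneg ((abs_nonneg _).trans (hT z (Metric.ball_subset_ball hrr₁ hz))) (by positivity)
  have hdiff : |annulusIntegral G α ε r v - (T ε - T r)| ≤
      C₁ * L * ∫ z in Metric.ball (0 : EuclideanSpace ℝ (Fin (m + 1))) r, ‖z‖ ^ 2 / ‖z‖ ^ p := by
    rw [hTsub, annulusIntegral, ← integral_sub hI2 hI1, ← integral_const_mul]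
    have hpt : ∀ z ∈ Metric.ball (0 : EuclideanSpace ℝ (Fin (m + 1))) r,
        ‖G (inner ℝ v z) / ‖z‖ ^ p - G (u x - u (x + z)) / ‖z‖ ^ p‖
          ≤ C₁ * L * (‖z‖ ^ 2 / ‖z‖ ^ p) := by
      intro z hz
      have hz1 : ‖z‖ < r := by simpa using hz
      have hb1 : |inner ℝ v z| ≤ max (2 * M) ‖v‖ := by
        refine le_trans ?_ (le_max_right _ _)
        refine (abs_real_inner_le_norm v z).trans ?_
        nlinarith [norm_nonneg v]
      have hb2 : |u x - u (x + z)| ≤ max (2 * M) ‖v‖ := by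
        refine le_trans ?_ (le_max_left _ _)
        refine (abs_sub _ _).trans ?_
        linarith [hM x, hM (x + z)]
      have h3 := (hC₁' _ _ hb1 hb2).trans (mul_le_mul_of_nonneg_left
        (hT z (Metric.ball_subset_ball hrr₁ hz)) hC₁.le)
      rw [← sub_div, norm_div, Real.norm_of_nonneg (Real.rpow_nonneg (norm_nonneg z) p),
        ← mul_div_assoc]
      refine div_le_div_of_nonneg_right ?_ (by positivity)
      rw [mul_assoc]
      exact h3
    refine (norm_integral_le_of_norm_le (IntegrableOn.mono_set (hI3.const_mul (C₁ * L)) Set.sdiff_subset)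
      ((ae_restrict_mem (measurableSet_ball.diff measurableSet_ball)).mono
        fun z hz => hpt z hz.1)).trans ?_
    refine setIntegral_mono_set (hI3.const_mul (C₁ * L)) ?_
      (LE.le.eventuallyLE Set.sdiff_subset)
    exact (ae_restrict_mem measurableSet_ball).mono fun z hz => (norm_nonneg _).trans (hpt z hz)
  have h4 : |annulusIntegral G α ε r v|
      ≤ |annulusIntegral G α ε r v - (T ε - T r)| + |T ε - T r| := by
    simpa using abs_add_le (annulusIntegral G α ε r v - (T ε - T r)) (T ε - T r)
  linarith

/-- The truncated operator on linear functions is bounded by a multiple of the gradient, uniformly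
in the truncation, as soon as it is bounded for one nonzero gradient. -/
lemma exists_annulusIntegral_le {m : ℕ} {G : ℝ → ℝ} {α : ℝ} (hG : Continuous G) (hG0 : G 0 = 0)
    (hGL : LipschitzOnBounded G)
    {v₀ : EuclideanSpace ℝ (Fin (m + 1))} (hv₀ : v₀ ≠ 0) {r₀ C₀ : ℝ} (hr₀ : 0 < r₀)
    (hC₀ : ∀ ε, 0 < ε → ε ≤ r₀ → |annulusIntegral G α ε r₀ v₀| ≤ C₀) {P : ℝ} (hP : 0 < P) :
    ∃ r C : ℝ, 0 < r ∧ r ≤ 1 ∧ 0 ≤ C ∧ ∀ v : EuclideanSpace ℝ (Fin (m + 1)), ‖v‖ ≤ P →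
      ∀ ε, 0 < ε → ε ≤ r → annulusIntegral G α ε r v ≤ C * ‖v‖ := by
  rcases lt_or_ge α 1 with hα1 | hα1
  -- For `α < 1` the linear term is absolutely integrable against the kernel, so no cancellation is
  -- needed.
  · obtain ⟨C₁, hC₁, hC₁'⟩ := hGL P
    have hI : IntegrableOn (fun z : EuclideanSpace ℝ (Fin (m + 1)) =>
        ‖z‖ ^ 1 / ‖z‖ ^ (((m + 1 : ℕ) : ℝ) + α)) (Metric.ball 0 1) :=
      integrableOn_ball_pow_mul_kernel 1 (by exact_mod_cast hα1) 1
    refine ⟨1, C₁ * ∫ z in Metric.ball (0 : EuclideanSpace ℝ (Fin (m + 1))) 1,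
      ‖z‖ ^ 1 / ‖z‖ ^ (((m + 1 : ℕ) : ℝ) + α), one_pos, le_rfl, ?_, fun v hv ε hε hε1 => ?_⟩
    · exact mul_nonneg hC₁.le (setIntegral_nonneg measurableSet_ball fun z _ => by positivity)
    · rw [mul_right_comm, ← integral_const_mul, annulusIntegral]
      have hpt : ∀ z ∈ Metric.ball (0 : EuclideanSpace ℝ (Fin (m + 1))) 1,
          G (inner ℝ v z) / ‖z‖ ^ (((m + 1 : ℕ) : ℝ) + α)
            ≤ C₁ * ‖v‖ * (‖z‖ ^ 1 / ‖z‖ ^ (((m + 1 : ℕ) : ℝ) + α)) := by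
        intro z hz
        have hz1 : ‖z‖ < 1 := by simpa using hz
        have hin := abs_real_inner_le_norm v z
        have hb : |inner ℝ v z| ≤ P := hin.trans (by nlinarith [norm_nonneg v])
        have h1 := hC₁' (inner ℝ v z) 0 hb (by simpa using hP.le)
        rw [hG0, sub_zero, sub_zero] at h1
        rw [← mul_div_assoc]
        refine div_le_div_of_nonneg_right ?_ (by positivity)
        rw [pow_one, mul_assoc]
        exact (le_abs_self _).trans (h1.trans (mul_le_mul_of_nonneg_left hin hC₁.le))
      refine (setIntegral_mono_on (integrableOn_annulus (f := fun z => G (inner ℝ v z))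
        (by fun_prop) hε 1 _) (IntegrableOn.mono_set (hI.const_mul (C₁ * ‖v‖)) Set.sdiff_subset)
        (measurableSet_ball.diff measurableSet_ball) fun z hz => hpt z hz.1).trans ?_
      refine setIntegral_mono_set (hI.const_mul (C₁ * ‖v‖)) ?_
        (LE.le.eventuallyLE Set.sdiff_subset)
      exact Eventually.of_forall fun z => by simp only [Pi.zero_apply]; positivity
  · have hn : 0 < ‖v₀‖ := norm_pos_iff.2 hv₀
    have hC₀0 : 0 ≤ C₀ := (abs_nonneg _).trans (hC₀ r₀ hr₀ le_rfl)
    -- The scaling factor `t = ‖v‖ / ‖v₀‖` is at most `P / ‖v₀‖`, so this radius keeps `t * r ≤ r₀`.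
    -- The factor `2 * C₀` comes from writing the annulus from `tε` to `tr` as a difference of two
    -- annuli ending at `r₀`. As `α ≥ 1`, `t ^ α` is at most a multiple of `t`, which makes the
    -- bound linear in `‖v‖`.
    refine ⟨min 1 (r₀ * ‖v₀‖ / P), (P / ‖v₀‖) ^ (α - 1) / ‖v₀‖ * (2 * C₀), by positivity,
      min_le_left _ _, by positivity, fun v hv ε hε hεr => ?_⟩
    set r := min 1 (r₀ * ‖v₀‖ / P) with hr
    rcases eq_or_ne v 0 with rfl | hv0
    · simp [annulusIntegral, hG0]
    have hvn : 0 < ‖v‖ := norm_pos_iff.2 hv0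
    set t := ‖v‖ / ‖v₀‖ with ht
    have ht0 : 0 < t := by positivity
    have htr : t * r ≤ r₀ := by
      have h1 : t ≤ P / ‖v₀‖ := div_le_div_of_nonneg_right hv hn.le
      have h2 : r ≤ r₀ * ‖v₀‖ / P := min_le_right _ _
      calc t * r ≤ P / ‖v₀‖ * (r₀ * ‖v₀‖ / P) :=
            mul_le_mul h1 h2 (hε.le.trans hεr) (by positivity)
        _ = r₀ := by field_simp
    have hε' : 0 < t * ε := by positivity
    have hεr' : t * ε ≤ t * r := mul_le_mul_of_nonneg_left hεr ht0.le
    have hnorm : ‖v‖ = ‖t • v₀‖ := by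
      rw [norm_smul, Real.norm_of_nonneg ht0.le, ht]; field_simp
    rw [annulusIntegral_congr_norm ε r hnorm, annulusIntegral_smul ε r ht0]
    have hsplit := annulusIntegral_add (α := α) hG hε' hεr' htr v₀
    have h1 := abs_le.1 (hC₀ (t * ε) hε' (hεr'.trans htr))
    have h2 := abs_le.1 (hC₀ (t * r) (hε'.trans_le hεr') htr)
    have h3 : annulusIntegral G α (t * ε) (t * r) v₀ ≤ 2 * C₀ := by linarith
    have h4 : t ^ α ≤ (P / ‖v₀‖) ^ (α - 1) / ‖v₀‖ * ‖v‖ := by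
      have : t ^ α = t ^ (α - 1) * t := by
        rw [← Real.rpow_add_one ht0.ne', sub_add_cancel]
      rw [this, div_mul_eq_mul_div, mul_div_assoc]
      refine mul_le_mul_of_nonneg_right (Real.rpow_le_rpow ht0.le ?_ (by linarith)) ht0.le
      exact div_le_div_of_nonneg_right hv hn.le
    calc t ^ α * annulusIntegral G α (t * ε) (t * r) v₀
        ≤ t ^ α * (2 * C₀) := mul_le_mul_of_nonneg_left h3 (by positivity)
      _ ≤ (P / ‖v₀‖) ^ (α - 1) / ‖v₀‖ * ‖v‖ * (2 * C₀) :=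
          mul_le_mul_of_nonneg_right h4 (by positivity)
      _ = (P / ‖v₀‖) ^ (α - 1) / ‖v₀‖ * (2 * C₀) * ‖v‖ := by ring

lemma compl_ball_integral_eq {n : ℕ} (f : EuclideanSpace ℝ (Fin n) → ℝ)
    (x : EuclideanSpace ℝ (Fin n)) (r : ℝ) :
    ∫ z in (Metric.ball x r)ᶜ, f z = ∫ z in (Metric.ball 0 r)ᶜ, f (x + z) := by
  rw [← (measurePreserving_add_left volume x).setIntegral_preimage_emb
    (measurableEmbedding_addLeft x)]
  congr 2
  ext z
  simp

/-! ### Touching from below by paraboloids and a weak Harnack bound. -/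

/-- A nonnegative continuous function that dips below the paraboloid of height `κ` on a unit ball
is touched from below by a translate of that paraboloid. -/
lemma exists_paraboloid_touching {n : ℕ} {u : EuclideanSpace ℝ (Fin n) → ℝ} (hu : Continuous u)
    (hu0 : ∀ x, 0 ≤ u x) {κ : ℝ} (hκ : 0 < κ) {z : EuclideanSpace ℝ (Fin n)}
    (hex : ∃ y ∈ Metric.ball z 1, u y < κ * (1 - ‖y - z‖ ^ 2)) :
    ∃ y₀, ‖y₀ - z‖ < 1 ∧ u y₀ ≤ κ ∧ ∀ ζ,
      u y₀ - u (y₀ + ζ) ≤ inner ℝ ((2 * κ) • (y₀ - z)) ζ + κ * ‖ζ‖ ^ 2 := by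
  obtain ⟨y₁, hy₁, hy₁'⟩ := hex
  obtain ⟨y₀, hy₀, hmin⟩ := (isCompact_closedBall z 1).exists_isMinOn
    (Metric.nonempty_closedBall.2 zero_le_one)
    (f := fun y => u y - κ * (1 - ‖y - z‖ ^ 2)) (by fun_prop)
  have hlt : u y₀ - κ * (1 - ‖y₀ - z‖ ^ 2) < 0 :=
    lt_of_le_of_lt (hmin (Metric.ball_subset_closedBall hy₁)) (by simpa using hy₁')
  have hy₀n : ‖y₀ - z‖ < 1 := by
    by_contra hcon
    have h1 : 1 ≤ ‖y₀ - z‖ := not_lt.1 hcon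
    have h2 : κ * (1 - ‖y₀ - z‖ ^ 2) ≤ 0 := mul_nonpos_of_nonneg_of_nonpos hκ.le (by nlinarith)
    linarith [hu0 y₀]
  -- Contact is global: outside the unit ball the paraboloid is nonpositive while `u ≥ 0`, and the
  -- minimum of the difference is negative.
  have htouch : ∀ y, u y₀ - u y ≤ κ * (‖y - z‖ ^ 2 - ‖y₀ - z‖ ^ 2) := by
    intro y
    by_cases hy : ‖y - z‖ ≤ 1
    · have := hmin (show y ∈ Metric.closedBall z 1 by rwa [Metric.mem_closedBall, dist_eq_norm])
      simp only [Set.mem_ofPred_eq] at this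
      linarith
    · have h1 : 1 ≤ ‖y - z‖ ^ 2 := one_le_pow₀ (not_le.1 hy).le
      nlinarith [hu0 y]
  refine ⟨y₀, hy₀n, by nlinarith [sq_nonneg ‖y₀ - z‖], fun ζ => ?_⟩
  have e : ‖y₀ + ζ - z‖ ^ 2 = ‖y₀ - z‖ ^ 2 + 2 * inner ℝ (y₀ - z) ζ + ‖ζ‖ ^ 2 := by
    rw [add_sub_right_comm, norm_add_sq_real]
  refine (htouch (y₀ + ζ)).trans (le_of_eq ?_)
  rw [e, inner_smul_left]
  simp only [conj_trivial]
  ring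

/-- If a nonnegative supersolution dips below the paraboloid of height `κ` on a unit ball, then its
integrals away from that ball are at most a multiple of `κ`. -/
lemma exists_setIntegral_le_of_paraboloid {m : ℕ} {G : ℝ → ℝ} {α c₀ : ℝ} (hα0 : 0 < α)
    (hα2 : α < 2) (hG : Continuous G) (hG0 : G 0 = 0) (hGL : LipschitzOnBounded G) (hc₀ : 0 < c₀)
    (hGm : ∀ s t, s ≤ t → c₀ * (t - s) ≤ G t - G s)
    {u : EuclideanSpace ℝ (Fin (m + 1)) → ℝ} (hu : Continuous u) (hu0 : ∀ x, 0 ≤ u x)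
    {Ω : Set (EuclideanSpace ℝ (Fin (m + 1)))} {K : ℝ} (hK : 0 ≤ K)
    {F : EuclideanSpace ℝ (Fin (m + 1)) → ℝ} (hF : ∀ x ∈ Ω, HasFAlpha G α u x (F x))
    (hFK : ∀ x ∈ Ω, -(K * u x) ≤ F x)
    {v₀ : EuclideanSpace ℝ (Fin (m + 1))} (hv₀ : v₀ ≠ 0) {r₀ C₀ : ℝ} (hr₀ : 0 < r₀)
    (hC₀ : ∀ ε, 0 < ε → ε ≤ r₀ → |annulusIntegral G α ε r₀ v₀| ≤ C₀)
    {κm : ℝ} (hκm : 0 < κm) {L : ℝ} (hL : 0 < L) :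
    ∃ C : ℝ, 0 < C ∧ ∀ (κ : ℝ) (z : EuclideanSpace ℝ (Fin (m + 1)))
      (S : Set (EuclideanSpace ℝ (Fin (m + 1)))), 0 < κ → κ ≤ κm → Metric.ball z 1 ⊆ Ω →
      (∃ y ∈ Metric.ball z 1, u y < κ * (1 - ‖y - z‖ ^ 2)) → MeasurableSet S →
      (∀ y ∈ S, 2 ≤ ‖y - z‖) → S ⊆ Metric.ball z L → ∫ y in S, u y ≤ C * κ := by
  set p : ℝ := ((m + 1 : ℕ) : ℝ) + α with hp
  have hp0 : 0 < p := by positivity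
  have hCn := normConst_pos (m + 1) hα0 hα2
  obtain ⟨r, CJ, hr, hr1, hCJ, hJ⟩ := exists_annulusIntegral_le (α := α) hG hG0 hGL hv₀ hr₀ hC₀
    (P := 2 * κm) (by positivity)
  -- On the unit ball the linear part is at most `2κ` and the quadratic part at most `κ`.
  obtain ⟨C₁, hC₁, hC₁'⟩ := hGL (3 * κm)
  set I₂ := ∫ z in Metric.ball (0 : EuclideanSpace ℝ (Fin (m + 1))) r, ‖z‖ ^ 2 / ‖z‖ ^ p with hI₂
  set I₃ := ∫ z in (Metric.ball (0 : EuclideanSpace ℝ (Fin (m + 1))) r)ᶜ, 1 / ‖z‖ ^ p with hI₃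
  have hI₂0 : 0 ≤ I₂ := setIntegral_nonneg measurableSet_ball fun z _ => by positivity
  have hI₃0 : 0 ≤ I₃ := setIntegral_nonneg measurableSet_ball.compl fun z _ => by positivity
  set k₀ := 1 / (L + 1) ^ p with hk₀
  have hk₀0 : 0 < k₀ := by positivity
  refine ⟨(CJ * 2 + C₁ * I₂ + C₁ * I₃ + K / normConst (m + 1) α + 1) / (c₀ * k₀), by positivity,
    fun κ z S hκ hκm' hzΩ hex hS hS2 hSL => ?_⟩
  obtain ⟨y₀, hy₀n, huκ, htouch⟩ := exists_paraboloid_touching hu hu0 hκ hex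
  have hy₀Ω : y₀ ∈ Ω := hzΩ (by rwa [Metric.mem_ball, dist_eq_norm])
  set v : EuclideanSpace ℝ (Fin (m + 1)) := (2 * κ) • (y₀ - z) with hv
  have hvn : ‖v‖ ≤ 2 * κ := by
    rw [hv, norm_smul, Real.norm_of_nonneg (by positivity)]
    nlinarith
  have hmono : ∀ s t, s ≤ t → G s ≤ G t := fun s t hst => by
    linarith [hGm s t hst, mul_nonneg hc₀.le (sub_nonneg.2 hst)]
  have hann : ∀ ζ ∈ Metric.ball (0 : EuclideanSpace ℝ (Fin (m + 1))) r,
      G (u y₀ - u (y₀ + ζ)) ≤ G (inner ℝ v ζ) + C₁ * κ * ‖ζ‖ ^ 2 := by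
    intro ζ hζ
    have hζ1 : ‖ζ‖ ≤ 1 := by
      have : ‖ζ‖ < r := by simpa using hζ
      linarith
    have h1 := htouch ζ
    have hin : |inner ℝ v ζ| ≤ 2 * κ :=
      (abs_real_inner_le_norm v ζ).trans (by nlinarith [norm_nonneg v, norm_nonneg ζ])
    have hsq : ‖ζ‖ ^ 2 ≤ 1 := pow_le_one₀ (norm_nonneg _) hζ1
    have hκζ : 0 ≤ κ * ‖ζ‖ ^ 2 := by positivity
    have hκζ' : κ * ‖ζ‖ ^ 2 ≤ κ := by nlinarith
    rw [abs_le] at hin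
    have h2 := hC₁' (inner ℝ v ζ + κ * ‖ζ‖ ^ 2) (inner ℝ v ζ)
      (abs_le.2 ⟨by linarith, by linarith⟩) (abs_le.2 ⟨by linarith, by linarith⟩)
    rw [add_sub_cancel_left, abs_of_nonneg hκζ] at h2
    have h3 := (le_abs_self _).trans h2
    have h4 := hmono _ _ h1
    linarith
  -- Away from the contact point, the growth of `G` turns `u y` into a gain `-c₀ * u y`, and `G (u
  -- y₀)` costs only `O(κ)`. This gain is what bounds the mass of `u`.
  have hext : ∀ y, G (u y₀ - u y) ≤ C₁ * κ - c₀ * u y := by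
    intro y
    have h1 := hGm (u y₀ - u y) (u y₀) (by linarith [hu0 y])
    have h2 := hC₁' (u y₀) 0 (by rw [abs_of_nonneg (hu0 _)]; linarith) (by simp; linarith)
    rw [hG0, sub_zero, sub_zero, abs_of_nonneg (hu0 y₀)] at h2
    have h3 := (le_abs_self _).trans h2
    have h4 := mul_le_mul_of_nonneg_left huκ hC₁.le
    linarith
  -- integrability facts
  have hI2 : IntegrableOn (fun ζ : EuclideanSpace ℝ (Fin (m + 1)) =>
      C₁ * κ * (‖ζ‖ ^ 2 / ‖ζ‖ ^ p)) (Metric.ball 0 r) :=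
    (integrableOn_ball_pow_mul_kernel 2 (by exact_mod_cast hα2) r).const_mul _
  have huS : IntegrableOn u S := (hu.continuousOn.integrableOn_compact
    (isCompact_closedBall z L)).mono_set (hSL.trans Metric.ball_subset_closedBall)
  have hSr : S ⊆ (Metric.ball y₀ r)ᶜ := by
    intro y hy hy'
    rw [Metric.mem_ball, dist_eq_norm] at hy'
    have h1 := hS2 y hy
    have h2 := norm_sub_le_norm_sub_add_norm_sub y y₀ z
    linarith
  set T : ℝ → ℝ := fun ε => ∫ z in (Metric.ball y₀ ε)ᶜ, G (u y₀ - u z) / ‖y₀ - z‖ ^ p with hT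
  have hTr : T r ≤ C₁ * κ * I₃ - c₀ * k₀ * ∫ y in S, u y := by
    have hk := integrableOn_kernel_compl_ball hα0 y₀ hr
    rw [← hp] at hk
    have hk3 : ∫ z in (Metric.ball y₀ r)ᶜ, 1 / ‖y₀ - z‖ ^ p = I₃ := by
      rw [compl_ball_integral_eq]
      simp only [sub_add_cancel_left, norm_neg, hI₃]
    have hind : IntegrableOn (S.indicator u) (Metric.ball y₀ r)ᶜ :=
      ((integrable_indicator_iff hS).2 huS).integrableOn
    have hind' : ∫ y in (Metric.ball y₀ r)ᶜ, S.indicator u y = ∫ y in S, u y := by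
      rw [setIntegral_indicator hS, Set.inter_eq_self_of_subset_right hSr]
    have hle : T r ≤ ∫ y in (Metric.ball y₀ r)ᶜ,
        (C₁ * κ * (1 / ‖y₀ - y‖ ^ p) - c₀ * k₀ * S.indicator u y) := by
      refine setIntegral_mono_on ((hF y₀ hy₀Ω).1 r hr)
        ((hk.const_mul _).sub (hind.const_mul _)) measurableSet_ball.compl fun y hy => ?_
      have hyr : r ≤ ‖y₀ - y‖ := by
        simpa [dist_eq_norm, norm_sub_rev] using hy
      have hypos : 0 < ‖y₀ - y‖ := hr.trans_le hyr
      have h1 : G (u y₀ - u y) / ‖y₀ - y‖ ^ p ≤ (C₁ * κ - c₀ * u y) * (1 / ‖y₀ - y‖ ^ p) := by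
        rw [mul_one_div]
        exact div_le_div_of_nonneg_right (hext y) (by positivity)
      have h2 : k₀ * S.indicator u y ≤ u y * (1 / ‖y₀ - y‖ ^ p) := by
        by_cases hyS : y ∈ S
        · rw [Set.indicator_of_mem hyS, mul_comm]
          refine mul_le_mul_of_nonneg_left (one_div_le_one_div_of_le (by positivity)
            (Real.rpow_le_rpow hypos.le ?_ hp0.le)) (hu0 y)
          have h3 : ‖y - z‖ < L := by simpa [dist_eq_norm] using hSL hyS
          have h4 := norm_sub_le_norm_sub_add_norm_sub y₀ z y
          rw [norm_sub_rev z y] at h4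
          linarith
        · rw [Set.indicator_of_notMem hyS, mul_zero]
          exact mul_nonneg (hu0 y) (by positivity)
      have h3 := mul_le_mul_of_nonneg_left h2 hc₀.le
      linarith
    rw [integral_sub (hk.const_mul _) (hind.const_mul _), integral_const_mul, integral_const_mul,
      hk3, hind'] at hle
    exact hle
  have hTε : ∀ ε, 0 < ε → ε ≤ r → T ε ≤ CJ * (2 * κ) + C₁ * κ * I₂ + T r := by
    intro ε hε hεr
    have h1 : T ε = (∫ ζ in Metric.ball 0 r \ Metric.ball 0 ε,
        G (u y₀ - u (y₀ + ζ)) / ‖ζ‖ ^ p) + T r := by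
      simp only [hT]
      rw [compl_ball_integral_sub hεr ((hF y₀ hy₀Ω).1 ε hε), sdiff_ball_integral_eq]
      simp only [sub_add_cancel_left, norm_neg, ← hp]
    have hJI : IntegrableOn (fun ζ : EuclideanSpace ℝ (Fin (m + 1)) =>
        G (inner ℝ v ζ) / ‖ζ‖ ^ p) (Metric.ball 0 r \ Metric.ball 0 ε) :=
      integrableOn_annulus (f := fun ζ => G (inner ℝ v ζ)) (by fun_prop) hε r p
    have hI2' := IntegrableOn.mono_set hI2 (Set.sdiff_subset (t := Metric.ball 0 ε))
    have h2 : (∫ ζ in Metric.ball 0 r \ Metric.ball 0 ε, G (u y₀ - u (y₀ + ζ)) / ‖ζ‖ ^ p)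
        ≤ ∫ ζ in Metric.ball 0 r \ Metric.ball 0 ε,
          (G (inner ℝ v ζ) / ‖ζ‖ ^ p + C₁ * κ * (‖ζ‖ ^ 2 / ‖ζ‖ ^ p)) := by
      refine setIntegral_mono_on
        (integrableOn_annulus (f := fun ζ => G (u y₀ - u (y₀ + ζ))) (by fun_prop) hε r p)
        (hJI.add hI2') (measurableSet_ball.diff measurableSet_ball) fun ζ hζ => ?_
      rw [← mul_div_assoc, ← add_div]
      exact div_le_div_of_nonneg_right (hann ζ hζ.1) (by positivity)
    rw [integral_add hJI hI2'] at h2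
    have h3 : ∫ ζ in Metric.ball 0 r \ Metric.ball (0 : EuclideanSpace ℝ (Fin (m + 1))) ε,
        C₁ * κ * (‖ζ‖ ^ 2 / ‖ζ‖ ^ p) ≤ C₁ * κ * I₂ := by
      rw [hI₂, ← integral_const_mul]
      refine setIntegral_mono_set hI2 ?_ (LE.le.eventuallyLE Set.sdiff_subset)
      exact Eventually.of_forall fun ζ => by simp only [Pi.zero_apply]; positivity
    have h4 : ∫ ζ in Metric.ball 0 r \ Metric.ball 0 ε, G (inner ℝ v ζ) / ‖ζ‖ ^ p
        ≤ CJ * (2 * κ) :=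
      (hJ v (by linarith) ε hε hεr).trans (mul_le_mul_of_nonneg_left hvn hCJ)
    linarith
  have hlim := (hF y₀ hy₀Ω).tendsto_integral hα0 hα2
  have hup : F y₀ / normConst (m + 1) α ≤ CJ * (2 * κ) + C₁ * κ * I₂ + T r := by
    refine le_of_tendsto hlim ?_
    filter_upwards [self_mem_nhdsWithin, mem_nhdsWithin_of_mem_nhds (Iio_mem_nhds hr)] with ε h1 h2
    exact hTε ε h1 (le_of_lt h2)
  have hlow : -(K / normConst (m + 1) α * κ) ≤ F y₀ / normConst (m + 1) α := by
    rw [div_mul_eq_mul_div, ← neg_div]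
    refine div_le_div_of_nonneg_right ?_ hCn.le
    have := hFK y₀ hy₀Ω
    have := mul_le_mul_of_nonneg_left huκ hK
    linarith
  rw [div_mul_eq_mul_div, le_div_iff₀ (by positivity)]
  linarith

/-! ### Tent functions as Lipschitz weights. -/

/-- The tent function of radius `ρ` centred at `q`. -/
noncomputable def tent {m : ℕ} (q : EuclideanSpace ℝ (Fin (m + 1))) (ρ : ℝ)
    (y : EuclideanSpace ℝ (Fin (m + 1))) : ℝ :=
  max 0 (1 - ‖y - q‖ / ρ)

section Tent

variable {m : ℕ} {q : EuclideanSpace ℝ (Fin (m + 1))} {ρ : ℝ}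

lemma tent_nonneg (y : EuclideanSpace ℝ (Fin (m + 1))) : 0 ≤ tent q ρ y := le_max_left _ _

lemma tent_le_one (hρ : 0 < ρ) (y : EuclideanSpace ℝ (Fin (m + 1))) : tent q ρ y ≤ 1 :=
  max_le zero_le_one (by have : 0 ≤ ‖y - q‖ / ρ := by positivity
                         linarith)

lemma tent_eq_zero (hρ : 0 < ρ) {y : EuclideanSpace ℝ (Fin (m + 1))} (hy : y ∉ Metric.ball q ρ) :
    tent q ρ y = 0 := by
  refine max_eq_left ?_
  rw [Metric.mem_ball, dist_eq_norm, not_lt] at hy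
  have : 1 ≤ ‖y - q‖ / ρ := (one_le_div hρ).2 hy
  linarith

lemma continuous_tent : Continuous (tent q ρ) := by
  unfold tent; fun_prop

lemma hasCompactSupport_tent (hρ : 0 < ρ) : HasCompactSupport (tent q ρ) :=
  HasCompactSupport.intro (isCompact_closedBall q ρ) fun _ hy =>
    tent_eq_zero hρ fun h => hy (Metric.ball_subset_closedBall h)

lemma tent_sub_le (hρ : 0 < ρ) (y w : EuclideanSpace ℝ (Fin (m + 1))) :
    tent q ρ y - tent q ρ (y + w) ≤ ‖w‖ / ρ := by
  have h1 : 1 - ‖y - q‖ / ρ ≤ tent q ρ (y + w) + ‖w‖ / ρ := by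
    have h2 : 1 - ‖y + w - q‖ / ρ ≤ tent q ρ (y + w) := le_max_right _ _
    have h3 : ‖y + w - q‖ ≤ ‖y - q‖ + ‖w‖ := by
      rw [add_sub_right_comm]; exact norm_add_le _ _
    have h4 := div_le_div_of_nonneg_right h3 hρ.le
    rw [add_div] at h4
    linarith
  have h5 : tent q ρ y ≤ tent q ρ (y + w) + ‖w‖ / ρ :=
    max_le (add_nonneg (tent_nonneg _) (by positivity)) h1
  linarith

/-- The tent is at least `1 / 2` on the ball of half the radius. -/
lemma le_integral_tent (hρ : 0 < ρ) :
    1 / 2 * ((ρ / 2) ^ (m + 1) *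
      volume.real (Metric.ball (0 : EuclideanSpace ℝ (Fin (m + 1))) 1)) ≤ ∫ y, tent q ρ y := by
  have hI : Integrable (tent q ρ) volume :=
    continuous_tent.integrable_of_hasCompactSupport (hasCompactSupport_tent hρ)
  rw [← volume_real_ball q (by positivity : 0 ≤ ρ / 2)]
  have h1 : ∫ y in Metric.ball q (ρ / 2), (1 / 2 : ℝ) ≤ ∫ y in Metric.ball q (ρ / 2), tent q ρ y := by
    refine setIntegral_mono_on (integrableOn_const measure_ball_lt_top.ne) hI.integrableOn
      measurableSet_ball fun y hy => ?_
    refine le_trans ?_ (le_max_right _ _)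
    rw [Metric.mem_ball, dist_eq_norm] at hy
    have : ‖y - q‖ / ρ ≤ 1 / 2 := by rw [div_le_iff₀ hρ]; linarith
    linarith
  rw [setIntegral_const, smul_eq_mul, mul_comm] at h1
  exact h1.trans (setIntegral_le_integral hI (Eventually.of_forall tent_nonneg))

/-- Summation by parts: translation invariance moves the difference from `u`, which has no modulus
of continuity here, to the tent, which is Lipschitz with constant `1 / ρ`. -/
lemma integral_sub_translate_mul_tent_le (hρ : 0 < ρ)
    {u : EuclideanSpace ℝ (Fin (m + 1)) → ℝ} (hu : Continuous u) (hu0 : ∀ x, 0 ≤ u x)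
    (w : EuclideanSpace ℝ (Fin (m + 1))) :
    ∫ y, (u y - u (y - w)) * tent q ρ y ≤ ‖w‖ / ρ * ∫ y in Metric.ball q (2 * ρ), u y := by
  have hI1 : Integrable (fun y => u y * tent q ρ y) volume :=
    (hu.mul continuous_tent).integrable_of_hasCompactSupport (hasCompactSupport_tent hρ).mul_left
  have hc : Continuous fun y => u (y - w) := by fun_prop
  have hI2 : Integrable (fun y => u (y - w) * tent q ρ y) volume :=
    (hc.mul continuous_tent).integrable_of_hasCompactSupport (hasCompactSupport_tent hρ).mul_left
  have hI3 : Integrable (fun y => u y * tent q ρ (y + w)) volume := by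
    simpa using hI2.comp_add_right w
  have e1 : ∫ y, u (y - w) * tent q ρ y = ∫ y, u y * tent q ρ (y + w) := by
    rw [← integral_add_right_eq_self (fun y => u (y - w) * tent q ρ y) w]
    simp
  have e2 : ∫ y, (u y - u (y - w)) * tent q ρ y = ∫ y, u y * (tent q ρ y - tent q ρ (y + w)) := by
    simp only [sub_mul, mul_sub]
    rw [integral_sub hI1 hI2, integral_sub hI1 hI3, e1]
  have huB : IntegrableOn u (Metric.ball q (2 * ρ)) := (hu.continuousOn.integrableOn_compact
    (isCompact_closedBall q (2 * ρ))).mono_set Metric.ball_subset_closedBall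
  rw [e2, ← integral_const_mul, ← integral_indicator measurableSet_ball]
  refine integral_mono ((hI1.sub hI3).congr (Eventually.of_forall fun y => (mul_sub _ _ _).symm))
    ((integrable_indicator_iff measurableSet_ball).2 (huB.const_mul _)) fun y => ?_
  by_cases hy : y ∈ Metric.ball q (2 * ρ)
  · rw [Set.indicator_of_mem hy, mul_comm]
    exact mul_le_mul_of_nonneg_right (tent_sub_le hρ y w) (hu0 y)
  · rw [Set.indicator_of_notMem hy, tent_eq_zero hρ fun h =>
      hy (Metric.ball_subset_ball (by linarith) h)]
    have := mul_nonneg (hu0 y) (tent_nonneg (q := q) (ρ := ρ) (y + w))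
    simp only [zero_sub, mul_neg]
    linarith

end Tent

/-! ### Consequences of the integrated comparison. -/

/-- The integrated form of the comparison between `x` and `reflect l x`: integrals over sets below
the mirror and away from `x` of any lower bound for the reflected increments are at most `B`. -/
def ReflectionBound {m : ℕ} (c₀ p l : ℝ) (u : EuclideanSpace ℝ (Fin (m + 1)) → ℝ)
    (x : EuclideanSpace ℝ (Fin (m + 1))) (B : ℝ) : Prop :=
  ∀ (S : Set (EuclideanSpace ℝ (Fin (m + 1)))) (g : EuclideanSpace ℝ (Fin (m + 1)) → ℝ) (r : ℝ),
    MeasurableSet S → (∀ y ∈ S, y (Fin.last m) < l) → 0 < r → (∀ y ∈ S, r ≤ ‖x - y‖) →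
    IntegrableOn g S →
    (∀ y ∈ S, g y ≤ c₀ * ((u (reflect l y) - u y) - (u (reflect l x) - u x)) *
        (1 / ‖x - y‖ ^ p - 1 / ‖x - reflect l y‖ ^ p) +
      2 * c₀ * (-(u (reflect l x) - u x)) * (1 / ‖x - reflect l y‖ ^ p)) →
    ∫ y in S, g y ≤ B

section

variable {m : ℕ} {c₀ p l B : ℝ} {u : EuclideanSpace ℝ (Fin (m + 1)) → ℝ}
  {x : EuclideanSpace ℝ (Fin (m + 1))}

lemma kernel_reflect_le (hp : 0 < p) (hx : x (Fin.last m) < l) {y : EuclideanSpace ℝ (Fin (m + 1))}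
    (hy : y (Fin.last m) ≤ l) (hxy : 0 < ‖x - y‖) :
    1 / ‖x - reflect l y‖ ^ p ≤ 1 / ‖x - y‖ ^ p :=
  one_div_le_one_div_of_le (by positivity)
    (Real.rpow_le_rpow hxy.le (norm_sub_le_norm_sub_reflect hx.le hy) hp.le)

lemma norm_sub_reflect_self (hx : x (Fin.last m) ≤ l) :
    ‖x - reflect l x‖ = 2 * (l - x (Fin.last m)) := by
  have : x - reflect l x = -((2 * (l - x (Fin.last m))) • lastVec m) := by
    simp only [reflect]; abel
  rw [this, norm_neg, norm_smul, norm_lastVec, mul_one, Real.norm_of_nonneg (by linarith)]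

/-- A quantitative bound on the distance of a negative minimum from the mirror. -/
lemma ReflectionBound.distance (hB : ReflectionBound c₀ p l u x B) (hc₀ : 0 < c₀) (hp : 0 < p)
    (hx : x (Fin.last m) < l) (hneg : u (reflect l x) < u x)
    (hmin : ∀ y : EuclideanSpace ℝ (Fin (m + 1)), y (Fin.last m) < l →
      u (reflect l x) - u x ≤ u (reflect l y) - u y) :
    2 * c₀ * (u x - u (reflect l x)) * (1 / (7 / 2 * (l - x (Fin.last m))) ^ p) *
      (((l - x (Fin.last m)) / 2) ^ (m + 1) *
        volume.real (Metric.ball (0 : EuclideanSpace ℝ (Fin (m + 1))) 1)) ≤ B := by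
  set δ := l - x (Fin.last m) with hδ
  have hδ0 : 0 < δ := by linarith
  -- On the ball of radius `δ / 2` about `q`, `‖x - reflect l y‖ ≤ 2δ + 3δ/2`, the first part being
  -- the distance from `x` to its image. Only the second term of the comparison is used.
  set q := x - δ • lastVec m with hq
  have hxq : ‖x - q‖ = δ := by
    rw [hq, sub_sub_cancel, norm_smul, norm_lastVec, mul_one, Real.norm_of_nonneg hδ0.le]
  have hqlast : q (Fin.last m) = x (Fin.last m) - δ := by simp [hq]
  have hdist : ∀ y ∈ Metric.ball q (δ / 2), ‖q - y‖ < δ / 2 := fun y hy => by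
    rwa [Metric.mem_ball, dist_eq_norm, norm_sub_rev] at hy
  have hlast : ∀ y ∈ Metric.ball q (δ / 2), y (Fin.last m) < l := fun y hy => by
    have := (abs_lt.1 (last_lt_of_mem_ball hy)).2
    linarith
  have hge : ∀ y ∈ Metric.ball q (δ / 2), δ / 2 ≤ ‖x - y‖ := fun y hy => by
    have h1 := norm_sub_le_norm_sub_add_norm_sub x y q
    have h2 := hdist y hy
    rw [norm_sub_rev y q] at h1
    linarith
  have key := hB (Metric.ball q (δ / 2))
    (fun _ => 2 * c₀ * (u x - u (reflect l x)) * (1 / (7 / 2 * δ) ^ p)) (δ / 2) measurableSet_ball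
    hlast (by positivity) hge (integrableOn_const measure_ball_lt_top.ne) fun y hy => by
      have hpos : 0 < ‖x - y‖ := lt_of_lt_of_le (by positivity) (hge y hy)
      have h1 := sub_nonneg.2 (hmin y (hlast y hy))
      have h2 := sub_nonneg.2 (kernel_reflect_le hp hx (hlast y hy).le hpos)
      have h3 : ‖x - reflect l y‖ ≤ 7 / 2 * δ := by
        have e1 := norm_sub_le_norm_sub_add_norm_sub x (reflect l x) (reflect l y)
        rw [norm_reflect_sub_reflect, norm_sub_reflect_self hx.le] at e1
        have e2 := norm_sub_le_norm_sub_add_norm_sub x q y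
        have e3 := hdist y hy
        linarith
      have h4 : 0 < ‖x - reflect l y‖ :=
        hpos.trans_le (norm_sub_le_norm_sub_reflect hx.le (hlast y hy).le)
      have h5 : 1 / (7 / 2 * δ) ^ p ≤ 1 / ‖x - reflect l y‖ ^ p :=
        one_div_le_one_div_of_le (by positivity) (Real.rpow_le_rpow h4.le h3 hp.le)
      have h6 := mul_nonneg (mul_nonneg hc₀.le h1) h2
      have h7 := mul_le_mul_of_nonneg_left h5
        (mul_nonneg (mul_nonneg zero_le_two hc₀.le) (sub_nonneg.2 hneg.le))
      rw [neg_sub]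
      linarith
  rw [setIntegral_const, smul_eq_mul, volume_real_ball q (by positivity), mul_comm] at key
  exact key

/-- Integral bound for `u ∘ reflect l - u` over a ball where the kernel difference is at least
`k₀`. -/
lemma ReflectionBound.ball (hB : ReflectionBound c₀ p l u x B) (hc₀ : 0 < c₀)
    (hu : Continuous u) (hx : x (Fin.last m) < l) (hneg : u (reflect l x) < u x)
    (hmin : ∀ y : EuclideanSpace ℝ (Fin (m + 1)), y (Fin.last m) < l →
      u (reflect l x) - u x ≤ u (reflect l y) - u y)
    {q : EuclideanSpace ℝ (Fin (m + 1))} {ρ r k₀ : ℝ} (hr : 0 < r) (hk₀ : 0 < k₀)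
    (hlast : ∀ y ∈ Metric.ball q ρ, y (Fin.last m) < l) (hge : ∀ y ∈ Metric.ball q ρ, r ≤ ‖x - y‖)
    (hk : ∀ y ∈ Metric.ball q ρ, k₀ ≤ 1 / ‖x - y‖ ^ p - 1 / ‖x - reflect l y‖ ^ p) :
    ∫ y in Metric.ball q ρ, ((u (reflect l y) - u y) - (u (reflect l x) - u x))
      ≤ B / (c₀ * k₀) := by
  have hcont : Continuous fun y => (u (reflect l y) - u y) - (u (reflect l x) - u x) :=
    ((hu.comp (continuous_reflect l)).sub hu).sub continuous_const
  have hI : IntegrableOn (fun y => (u (reflect l y) - u y) - (u (reflect l x) - u x))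
      (Metric.ball q ρ) := (hcont.continuousOn.integrableOn_compact
    (isCompact_closedBall q ρ)).mono_set Metric.ball_subset_closedBall
  have key := hB (Metric.ball q ρ)
    (fun y => c₀ * k₀ * ((u (reflect l y) - u y) - (u (reflect l x) - u x))) r measurableSet_ball
    hlast hr hge (hI.const_mul _) fun y hy => by
      have hpos : 0 < ‖x - reflect l y‖ := (hr.trans_le (hge y hy)).trans_le
        (norm_sub_le_norm_sub_reflect hx.le (hlast y hy).le)
      have h1 := mul_le_mul_of_nonneg_left (hk y hy)
        (mul_nonneg hc₀.le (sub_nonneg.2 (hmin y (hlast y hy))))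
      have h2 : 0 ≤ 2 * c₀ * (-(u (reflect l x) - u x)) * (1 / ‖x - reflect l y‖ ^ p) := by
        have : 0 ≤ -(u (reflect l x) - u x) := by linarith
        positivity
      linarith
  rw [integral_const_mul] at key
  rw [le_div_iff₀ (by positivity), mul_comm]
  exact key

/-- The bound on a small ball next to `x`. -/
lemma ReflectionBound.near (hB : ReflectionBound c₀ p l u x B) (hc₀ : 0 < c₀) (hp : 1 ≤ p)
    (hu : Continuous u) (hx : x (Fin.last m) < l) (hneg : u (reflect l x) < u x)
    (hmin : ∀ y : EuclideanSpace ℝ (Fin (m + 1)), y (Fin.last m) < l →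
      u (reflect l x) - u x ≤ u (reflect l y) - u y)
    {ρ : ℝ} (hρ : 0 < ρ) (hρx : 6 * ρ ≤ l - x (Fin.last m)) :
    ∫ y in Metric.ball (x - (2 * ρ) • lastVec m) ρ,
      ((u (reflect l y) - u y) - (u (reflect l x) - u x)) ≤ B / (c₀ * (1 / (3 * ρ) ^ p / 2)) := by
  set q := x - (2 * ρ) • lastVec m with hq
  have hxq : ‖x - q‖ = 2 * ρ := by
    rw [hq, sub_sub_cancel, norm_smul, norm_lastVec, mul_one, Real.norm_of_nonneg (by positivity)]
  have hqlast : q (Fin.last m) = x (Fin.last m) - 2 * ρ := by simp [hq]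
  have hdist : ∀ y ∈ Metric.ball q ρ, ‖q - y‖ < ρ := fun y hy => by
    rwa [Metric.mem_ball, dist_eq_norm, norm_sub_rev] at hy
  have hlast : ∀ y ∈ Metric.ball q ρ, y (Fin.last m) < l := fun y hy => by
    have := (abs_lt.1 (last_lt_of_mem_ball hy)).2
    linarith
  have hge : ∀ y ∈ Metric.ball q ρ, ρ ≤ ‖x - y‖ := fun y hy => by
    have h1 := norm_sub_le_norm_sub_add_norm_sub x y q
    have h2 := hdist y hy
    rw [norm_sub_rev y q] at h1
    linarith
  refine hB.ball hc₀ hu hx hneg hmin hρ (by positivity) hlast hge fun y hy => ?_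
  have h1 : ‖x - y‖ ≤ 3 * ρ := by
    have e1 := norm_sub_le_norm_sub_add_norm_sub x q y
    have e2 := hdist y hy
    linarith
  have h0 : 0 < ‖x - y‖ := hρ.trans_le (hge y hy)
  -- The reflected point is at least twice as far away as the bound `3 * ρ` on `‖x - y‖`; as `p ≥
  -- 1`, this costs at most half of the kernel.
  have h2 : 2 * (3 * ρ) ≤ ‖x - reflect l y‖ := by
    have e1 := abs_last_le (x - reflect l y)
    rw [PiLp.sub_apply, reflect_last] at e1
    have e2 := hlast y hy
    have e3 := (abs_le.1 e1).1
    linarith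
  have h3 : 1 / (3 * ρ) ^ p ≤ 1 / ‖x - y‖ ^ p :=
    one_div_le_one_div_of_le (by positivity) (Real.rpow_le_rpow h0.le h1 (by linarith))
  have h4 : 1 / ‖x - reflect l y‖ ^ p ≤ 1 / (3 * ρ) ^ p / 2 := by
    rw [div_div]
    refine one_div_le_one_div_of_le (by positivity) ?_
    calc (3 * ρ) ^ p * 2 ≤ (3 * ρ) ^ p * 2 ^ p := by
          refine mul_le_mul_of_nonneg_left ?_ (by positivity)
          exact Real.self_le_rpow_of_one_le one_le_two hp
      _ = (2 * (3 * ρ)) ^ p := by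
          rw [mul_comm, Real.mul_rpow zero_le_two (by positivity)]
      _ ≤ ‖x - reflect l y‖ ^ p := Real.rpow_le_rpow (by positivity) h2 (by linarith)
  linarith

/-- A positive lower bound for the difference of the kernel and its reflection. -/
lemma kernel_sub_reflect_ge (hp : 0 < p) {L δ : ℝ} (hL : 0 < L) (hδ : 0 < δ)
    {y : EuclideanSpace ℝ (Fin (m + 1))} (hx : δ ≤ l - x (Fin.last m))
    (hy : 1 ≤ l - y (Fin.last m)) (hxy : 0 < ‖x - y‖) (hxyL : ‖x - y‖ ≤ L) :
    1 / L ^ p * (1 - 1 / √(1 + 4 * δ / L ^ 2) ^ p)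
      ≤ 1 / ‖x - y‖ ^ p - 1 / ‖x - reflect l y‖ ^ p := by
  set θ := √(1 + 4 * δ / L ^ 2) with hθ
  have hθ1 : 1 ≤ θ := Real.one_le_sqrt.2 (by have : 0 ≤ 4 * δ / L ^ 2 := by positivity
                                             linarith)
  have hθ0 : 0 < θ := by linarith
  have h1 : θ * ‖x - y‖ ≤ ‖x - reflect l y‖ := by
    refine le_of_sq_le_sq ?_ (norm_nonneg _)
    rw [mul_pow, hθ, Real.sq_sqrt (by positivity), norm_sub_reflect_sq]
    have e1 : 4 * δ / L ^ 2 * ‖x - y‖ ^ 2 ≤ 4 * δ := by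
      rw [div_mul_eq_mul_div, div_le_iff₀ (by positivity)]
      exact mul_le_mul_of_nonneg_left (pow_le_pow_left₀ hxy.le hxyL 2) (by positivity)
    have e2 : δ * 1 ≤ (l - x (Fin.last m)) * (l - y (Fin.last m)) :=
      mul_le_mul hx hy zero_le_one (hδ.le.trans hx)
    linarith
  have h2 : 1 / ‖x - reflect l y‖ ^ p ≤ 1 / ‖x - y‖ ^ p * (1 / θ ^ p) := by
    rw [div_mul_div_comm, one_mul, mul_comm, ← Real.mul_rpow hθ0.le hxy.le]
    exact one_div_le_one_div_of_le (by positivity) (Real.rpow_le_rpow (by positivity) h1 hp.le)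
  have h3 : 1 / L ^ p ≤ 1 / ‖x - y‖ ^ p :=
    one_div_le_one_div_of_le (by positivity) (Real.rpow_le_rpow hxy.le hxyL hp.le)
  have h4 : 0 ≤ 1 - 1 / θ ^ p := by
    rw [sub_nonneg, div_le_one (by positivity)]
    exact Real.one_le_rpow hθ1 hp.le
  have h5 := mul_le_mul_of_nonneg_right h3 h4
  linarith

/-- The mass of `u` on a unit ball above the mirror image of the boundary. -/
lemma ReflectionBound.far (hB : ReflectionBound c₀ p l u x B) (hc₀ : 0 < c₀) (hp : 0 < p)
    (hu : Continuous u)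
    (hu_ext : ∀ x ∉ upperHalfSpace m, u x = 0) (hx0 : 0 < x (Fin.last m))
    (hx : x (Fin.last m) < l) (hneg : u (reflect l x) < u x)
    (hmin : ∀ y : EuclideanSpace ℝ (Fin (m + 1)), y (Fin.last m) < l →
      u (reflect l x) - u x ≤ u (reflect l y) - u y)
    {Λ δ : ℝ} (hl : l ≤ Λ) (hδ : 0 < δ) (hxδ : δ ≤ l - x (Fin.last m)) :
    ∫ y in Metric.ball (x + (2 * l + 2 - x (Fin.last m)) • lastVec m) 1, u y ≤
      B / (c₀ * (1 / (Λ + 4) ^ p * (1 - 1 / √(1 + 4 * δ / (Λ + 4) ^ 2) ^ p))) := by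
  -- The unit ball about `q` lies strictly below the boundary. There `u = 0`, so the reflected
  -- increment is `u ∘ reflect l` itself.
  set q := x - (x (Fin.last m) + 2) • lastVec m with hq
  have hqlast : q (Fin.last m) = -2 := by simp [hq]
  have hΛ : 0 < Λ + 4 := by linarith
  have hxq : ‖x - q‖ = x (Fin.last m) + 2 := by
    rw [hq, sub_sub_cancel, norm_smul, norm_lastVec, mul_one, Real.norm_of_nonneg (by linarith)]
  have hrq : x + (2 * l + 2 - x (Fin.last m)) • lastVec m = reflect l q := by
    simp only [reflect, hqlast]
    rw [hq]
    module
  have hdist : ∀ y ∈ Metric.ball q 1, ‖q - y‖ < 1 := fun y hy => by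
    rwa [Metric.mem_ball, dist_eq_norm, norm_sub_rev] at hy
  have hlast : ∀ y ∈ Metric.ball q 1, y (Fin.last m) < -1 := fun y hy => by
    have := (abs_lt.1 (last_lt_of_mem_ball hy)).2
    linarith
  have hge : ∀ y ∈ Metric.ball q 1, 1 ≤ ‖x - y‖ := fun y hy => by
    have h1 := norm_sub_le_norm_sub_add_norm_sub x y q
    have h2 := hdist y hy
    rw [norm_sub_rev y q] at h1
    linarith
  have hkpos : 0 < 1 / (Λ + 4) ^ p * (1 - 1 / √(1 + 4 * δ / (Λ + 4) ^ 2) ^ p) := by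
    have h1 : 1 < √(1 + 4 * δ / (Λ + 4) ^ 2) := by
      rw [Real.lt_sqrt (by norm_num)]
      have : 0 < 4 * δ / (Λ + 4) ^ 2 := by positivity
      linarith
    have h2 := Real.one_lt_rpow h1 hp
    have h3 : 0 < 1 - 1 / √(1 + 4 * δ / (Λ + 4) ^ 2) ^ p := by
      rw [sub_pos, div_lt_one (by linarith)]
      exact h2
    positivity
  have key := hB.ball hc₀ hu hx hneg hmin one_pos hkpos
    (fun y hy => by linarith [hlast y hy]) hge fun y hy => by
      refine kernel_sub_reflect_ge hp hΛ hδ hxδ (by linarith [hlast y hy])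
        (one_pos.trans_le (hge y hy)) ?_
      have e1 := norm_sub_le_norm_sub_add_norm_sub x q y
      have e2 := hdist y hy
      linarith
  refine le_trans ?_ key
  rw [hrq, ← (measurePreserving_reflect l).setIntegral_preimage_emb (measurableEmbedding_reflect l),
    reflect_preimage_ball]
  have hc1 : Continuous fun y => u (reflect l y) := hu.comp (continuous_reflect l)
  have hc2 : Continuous fun y => (u (reflect l y) - u y) - (u (reflect l x) - u x) :=
    (hc1.sub hu).sub continuous_const
  refine setIntegral_mono_on
    ((hc1.continuousOn.integrableOn_compact (isCompact_closedBall q 1)).mono_set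
      Metric.ball_subset_closedBall)
    ((hc2.continuousOn.integrableOn_compact (isCompact_closedBall q 1)).mono_set
      Metric.ball_subset_closedBall) measurableSet_ball fun y hy => ?_
  have : u y = 0 := hu_ext y fun h => by
    have h1 : 0 < y (Fin.last m) := h
    linarith [hlast y hy]
  rw [this]
  linarith

end

/-! ### Attainment of the minimum, and the choice of constants. -/

/-- If reflection across the level `l` fails to increase `u` somewhere below, then the failure is
worst at some point of the half space below the level. -/
lemma exists_reflection_min {m : ℕ} {u : EuclideanSpace ℝ (Fin (m + 1)) → ℝ} (hu : Continuous u)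
    (hu_lim : Tendsto u (cocompact (EuclideanSpace ℝ (Fin (m + 1)))) (𝓝 0)) {l : ℝ}
    {y' : EuclideanSpace ℝ (Fin (m + 1))} (hy' : y' (Fin.last m) < l)
    (hlt : u (reflect l y') < u y') :
    ∃ x : EuclideanSpace ℝ (Fin (m + 1)), x (Fin.last m) < l ∧ u (reflect l x) < u x ∧
      ∀ y : EuclideanSpace ℝ (Fin (m + 1)), y (Fin.last m) < l →
        u (reflect l x) - u x ≤ u (reflect l y) - u y := by
  have hcont : Continuous fun y => u (reflect l y) - u y := (hu.comp (continuous_reflect l)).sub hu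
  have hlim : Tendsto (fun y => u (reflect l y) - u y)
      (cocompact (EuclideanSpace ℝ (Fin (m + 1)))) (𝓝 0) := by
    simpa using
      (hu_lim.comp (isometry_reflect l).isClosedEmbedding.tendsto_cocompact).sub hu_lim
  have hclosed : IsClosed {y : EuclideanSpace ℝ (Fin (m + 1)) | y (Fin.last m) ≤ l} :=
    isClosed_le continuous_last continuous_const
  -- The increment tends to zero at infinity, so off a compact set it exceeds its negative value at
  -- `y'`. It vanishes on the mirror, so the minimum is not attained there.
  obtain ⟨x, hx, hxmin⟩ := hcont.continuousOn.exists_isMinOn' hclosed (x₀ := y') hy'.le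
    (Eventually.filter_mono inf_le_left
      ((hlim.eventually (lt_mem_nhds (show u (reflect l y') - u y' < 0 by linarith))).mono
        fun _ h => le_of_lt h))
  have hxneg : u (reflect l x) - u x < 0 := (hxmin hy'.le).trans_lt (by simpa using hlt)
  have hx' : x (Fin.last m) ≤ l := hx
  refine ⟨x, lt_of_le_of_ne hx' fun h => ?_, by linarith, fun y hy => hxmin hy.le⟩
  have : reflect l x = x := by simp [reflect, h]
  rw [this, sub_self] at hxneg
  exact lt_irrefl _ hxneg

/-- The volume `δ ^ (m + 1)` against the kernel leaves `δ ^ (-α)`, which blows up at the mirror. -/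
lemma exists_distance_threshold (m : ℕ) {α c₀ V K : ℝ} (hα0 : 0 < α) (hc₀ : 0 < c₀) (hV : 0 < V) :
    ∃ δ₀ : ℝ, 0 < δ₀ ∧ ∀ δ, 0 < δ → δ < δ₀ →
      K < 2 * c₀ * (1 / (7 / 2 * δ) ^ (((m + 1 : ℕ) : ℝ) + α)) * ((δ / 2) ^ (m + 1) * V) := by
  set A := 2 * c₀ * (1 / (7 / 2) ^ (((m + 1 : ℕ) : ℝ) + α)) * ((1 / 2) ^ (m + 1) * V) with hA
  have hA0 : 0 < A := by positivity
  have hev := (tendsto_rpow_neg_nhdsGT_zero (neg_lt_zero.2 hα0)).eventually_gt_atTop (K / A)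
  obtain ⟨δ₀, hδ₀, hsub⟩ := mem_nhdsGT_iff_exists_Ioo_subset.1 hev
  refine ⟨δ₀, hδ₀, fun δ h1 h2 => ?_⟩
  have h3 : K / A < δ ^ (-α) := hsub ⟨h1, h2⟩
  rw [div_lt_iff₀ hA0] at h3
  refine h3.trans_le (le_of_eq ?_)
  rw [Real.mul_rpow (by norm_num) h1.le, Real.rpow_add h1, Real.rpow_natCast,
    Real.rpow_neg h1.le, hA, div_pow, div_pow]
  have := Real.rpow_pos_of_pos h1 α
  field_simp
  exact one_pow _

/-- The left side scales like `ρ ^ (m + 1 + α)` and the right side like `ρ ^ (m + 1)`, so the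
surplus `ρ ^ α` absorbs every constant. -/
lemma exists_small_radius (m : ℕ) {α c₀ V K δ₀ : ℝ} (hα0 : 0 < α) (hc₀ : 0 < c₀) (hV : 0 < V)
    (hδ₀ : 0 < δ₀) :
    ∃ ρ : ℝ, 0 < ρ ∧ 6 * ρ ≤ δ₀ ∧ ρ ≤ 1 / 2 ∧
      K / (c₀ * (1 / (3 * ρ) ^ (((m + 1 : ℕ) : ℝ) + α) / 2))
        ≤ 1 / 4 * ((ρ / 2) ^ (m + 1) * V) := by
  set A := 2 * K * 3 ^ (((m + 1 : ℕ) : ℝ) + α) / c₀ with hA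
  have hlim : Tendsto (fun ρ : ℝ => A * ρ ^ α) (𝓝[>] 0) (𝓝 0) := by
    have h1 : Tendsto (fun ρ : ℝ => A * ρ ^ α) (𝓝 0) (𝓝 (A * 0 ^ α)) :=
      ((Real.continuous_rpow_const hα0.le).tendsto 0).const_mul A
    rw [Real.zero_rpow hα0.ne', mul_zero] at h1
    exact h1.mono_left nhdsWithin_le_nhds
  have hpos : 0 < 1 / 4 * ((1 / 2) ^ (m + 1) * V) := by positivity
  have hmin : 0 < min (δ₀ / 6) (1 / 2) := by positivity
  obtain ⟨ρ, h1, h2⟩ := ((hlim.eventually (gt_mem_nhds hpos)).and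
    (Ioo_mem_nhdsGT hmin)).exists
  have h4 : 0 < ρ := h2.1
  have h5 := h2.2.le.trans (min_le_left _ _)
  refine ⟨ρ, h4, by linarith, h2.2.le.trans (min_le_right _ _), ?_⟩
  have h5 : K / (c₀ * (1 / (3 * ρ) ^ (((m + 1 : ℕ) : ℝ) + α) / 2)) = A * ρ ^ α * ρ ^ (m + 1) := by
    rw [Real.mul_rpow (by norm_num) h4.le, hA, Real.rpow_add h4, Real.rpow_natCast]
    field_simp
  rw [h5]
  have h6 := mul_le_mul_of_nonneg_right h1.le (pow_nonneg h4.le (m + 1))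
  refine h6.trans (le_of_eq ?_)
  rw [div_pow, div_pow]
  ring

/-- If reflection at the level `l` increases `u` but the reflected increment at the level `l + η`
is on average close to its negative minimum over a ball, then `u` has a large mass near that ball
compared to `1 / η`. -/
lemma mul_le_of_average_near_min {m : ℕ} {u : EuclideanSpace ℝ (Fin (m + 1)) → ℝ}
    (hu : Continuous u) (hu0 : ∀ x, 0 ≤ u x) {l η ρ d : ℝ} (hη : 0 < η) (hρ : 0 < ρ) (hd : 0 ≤ d)
    (hmono : ∀ y : EuclideanSpace ℝ (Fin (m + 1)), y (Fin.last m) < l → u y ≤ u (reflect l y))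
    {q : EuclideanSpace ℝ (Fin (m + 1))}
    (hlast : ∀ y ∈ Metric.ball q ρ, y (Fin.last m) < l + η)
    (hmin : ∀ y ∈ Metric.ball q ρ, 0 ≤ u (reflect (l + η) y) - u y + d)
    (hq : ∫ y in Metric.ball q ρ, (u (reflect (l + η) y) - u y + d) ≤ 1 / 4 * ((ρ / 2) ^ (m + 1) *
      volume.real (Metric.ball (0 : EuclideanSpace ℝ (Fin (m + 1))) 1)) * d) :
    1 / 4 * ((ρ / 2) ^ (m + 1) *
      volume.real (Metric.ball (0 : EuclideanSpace ℝ (Fin (m + 1))) 1)) * d ≤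
      2 * η / ρ * ∫ y in Metric.ball q (2 * ρ), u y := by
  set w : EuclideanSpace ℝ (Fin (m + 1)) := (2 * η) • lastVec m with hw
  have hwn : ‖w‖ = 2 * η := by
    rw [hw, norm_smul, norm_lastVec, mul_one, Real.norm_of_nonneg (by positivity)]
  have hdrop : ∀ y ∈ Metric.ball q ρ, (d - (u y - u (y - w))) * tent q ρ y ≤
      u (reflect (l + η) y) - u y + d := by
    intro y hy
    have hylast := hlast y hy
    have h2 : (y - w) (Fin.last m) = y (Fin.last m) - 2 * η := by simp [hw]
    -- Reflecting `y` at level `l + η` is the same as reflecting `y - w` at level `l`, so the known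
    -- monotonicity compares `u` with its vertical translate.
    have h3 := hmono (y - w) (by rw [h2]; linarith)
    have h4 : reflect l (y - w) = reflect (l + η) y := by
      simp only [reflect, h2]
      rw [hw]
      module
    rw [h4] at h3
    have h6 : d - (u y - u (y - w)) ≤ u (reflect (l + η) y) - u y + d := by linarith
    calc (d - (u y - u (y - w))) * tent q ρ y
        ≤ (u (reflect (l + η) y) - u y + d) * tent q ρ y :=
          mul_le_mul_of_nonneg_right h6 (tent_nonneg y)
      _ ≤ (u (reflect (l + η) y) - u y + d) * 1 :=
          mul_le_mul_of_nonneg_left (tent_le_one hρ y) (hmin y hy)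
      _ = _ := mul_one _
  have hsup : HasCompactSupport (tent q ρ) := hasCompactSupport_tent hρ
  have hcw : Continuous fun y => u y - u (y - w) := by fun_prop
  have hI1 : Integrable (tent q ρ) volume := continuous_tent.integrable_of_hasCompactSupport hsup
  have hI2 : Integrable (fun y => (u y - u (y - w)) * tent q ρ y) volume :=
    (hcw.mul continuous_tent).integrable_of_hasCompactSupport hsup.mul_left
  have hI3 : Integrable (fun y => (d - (u y - u (y - w))) * tent q ρ y) volume :=
    ((continuous_const.sub hcw).mul continuous_tent).integrable_of_hasCompactSupport hsup.mul_left
  have hcR : Continuous fun y => u (reflect (l + η) y) - u y + d :=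
    ((hu.comp (continuous_reflect _)).sub hu).add continuous_const
  have e1 := (setIntegral_mono_on hI3.integrableOn ((hcR.continuousOn.integrableOn_compact
      (isCompact_closedBall q ρ)).mono_set Metric.ball_subset_closedBall)
      measurableSet_ball hdrop).trans hq
  rw [setIntegral_eq_integral_of_forall_compl_eq_zero
      fun y hy => by rw [tent_eq_zero hρ hy, mul_zero]] at e1
  have e2 : ∫ y, (d - (u y - u (y - w))) * tent q ρ y
      = d * (∫ y, tent q ρ y) - ∫ y, (u y - u (y - w)) * tent q ρ y := by
    rw [← integral_const_mul, ← integral_sub (hI1.const_mul d) hI2]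
    simp only [sub_mul]
  have e3 := integral_sub_translate_mul_tent_le (q := q) hρ hu hu0 w
  -- The tent has mass at least twice the coefficient `1 / 4 * ...` of `d` in the hypothesis, so
  -- half of the main term survives.
  have e5 := mul_le_mul_of_nonneg_left (le_integral_tent (q := q) hρ) hd
  rw [hwn] at e3
  linarith

/-! ### The uniform step from one level to the next. -/

section Step

variable {m : ℕ} {G : ℝ → ℝ} {α c₀ : ℝ} {u : EuclideanSpace ℝ (Fin (m + 1)) → ℝ} {M K : ℝ}
  {F : EuclideanSpace ℝ (Fin (m + 1)) → ℝ}

/-- Otherwise the half ball alone would carry too much mass. The smaller radius keeps the point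
where the paraboloid is at least `3 / 4` of its height. -/
lemma exists_le_of_setIntegral_le {n : ℕ} {u : EuclideanSpace ℝ (Fin (n + 1)) → ℝ}
    (hu : Continuous u) (hu0 : ∀ x, 0 ≤ u x) {z : EuclideanSpace ℝ (Fin (n + 1))} {a b : ℝ}
    (hb : b < (1 / 2) ^ (n + 1) *
      volume.real (Metric.ball (0 : EuclideanSpace ℝ (Fin (n + 1))) 1) * a)
    (hint : ∫ y in Metric.ball z 1, u y ≤ b) : ∃ y ∈ Metric.ball z (1 / 2), u y ≤ a := by
  by_contra! hno
  have huI : IntegrableOn u (Metric.ball z 1) := (hu.continuousOn.integrableOn_compact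
    (isCompact_closedBall z 1)).mono_set Metric.ball_subset_closedBall
  have hsub : Metric.ball z (1 / 2) ⊆ Metric.ball z 1 := Metric.ball_subset_ball (by norm_num)
  have h1 : ∫ y in Metric.ball z (1 / 2), a ≤ ∫ y in Metric.ball z (1 / 2), u y :=
    setIntegral_mono_on (integrableOn_const measure_ball_lt_top.ne) (huI.mono_set hsub)
      measurableSet_ball fun y hy => (hno y hy).le
  have h2 : ∫ y in Metric.ball z (1 / 2), u y ≤ ∫ y in Metric.ball z 1, u y :=
    setIntegral_mono_set huI (Eventually.of_forall hu0) (LE.le.eventuallyLE hsub)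
  rw [setIntegral_const, smul_eq_mul, volume_real_ball z (by norm_num)] at h1
  linarith

/-- At a point `x` where the increment of `u` under reflection has a negative minimum `-d`, the
mass of `u` near `x` is controlled by `d`. -/
lemma exists_setIntegral_le_at_reflection_min (hα0 : 0 < α)
    (hα2 : α < 2) (hG : Continuous G) (hG0 : G 0 = 0) (hGL : LipschitzOnBounded G) (hc₀ : 0 < c₀)
    (hGm : ∀ s t, s ≤ t → c₀ * (t - s) ≤ G t - G s)
    (hu : Continuous u) (hu0 : ∀ x, 0 ≤ u x) (hM : ∀ x, u x ≤ M)
    (hu_ext : ∀ x ∉ upperHalfSpace m, u x = 0)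
    (hK : 0 ≤ K) (hF : ∀ x ∈ upperHalfSpace m, HasFAlpha G α u x (F x))
    (hFK : ∀ x ∈ upperHalfSpace m, -(K * u x) ≤ F x)
    {v₀ : EuclideanSpace ℝ (Fin (m + 1))} (hv₀ : v₀ ≠ 0) {r₀ C₀ : ℝ} (hr₀ : 0 < r₀)
    (hC₀ : ∀ ε, 0 < ε → ε ≤ r₀ → |annulusIntegral G α ε r₀ v₀| ≤ C₀) {Λ δ ρ : ℝ} (hΛ : 0 < Λ)
    (hδ : 0 < δ) (hρ : 0 < ρ) (hρ1 : ρ ≤ 1 / 2) (B : ℝ) :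
    ∃ C : ℝ, 0 < C ∧ ∀ (l d : ℝ) (x : EuclideanSpace ℝ (Fin (m + 1))), l ≤ Λ → 0 < d →
      d = u x - u (reflect l x) →
      (∀ y : EuclideanSpace ℝ (Fin (m + 1)), y (Fin.last m) < l →
        u (reflect l x) - u x ≤ u (reflect l y) - u y) →
      0 < x (Fin.last m) → δ ≤ l - x (Fin.last m) →
      ReflectionBound c₀ (((m + 1 : ℕ) : ℝ) + α) l u x (B * d) →
      ∫ y in Metric.ball (x - (2 * ρ) • lastVec m) (2 * ρ), u y ≤ C * d := by
  set p : ℝ := ((m + 1 : ℕ) : ℝ) + α with hp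
  have hp0 : 0 < p := by positivity
  have hV0 : 0 < volume.real (Metric.ball (0 : EuclideanSpace ℝ (Fin (m + 1))) 1) :=
    volume_real_unitBall_pos
  set k₁ := c₀ * (1 / (Λ + 4) ^ p * (1 - 1 / √(1 + 4 * δ / (Λ + 4) ^ 2) ^ p)) with hk₁
  set M₁ := (|B / k₁| + 1) / ((1 / 2) ^ (m + 1) *
    volume.real (Metric.ball (0 : EuclideanSpace ℝ (Fin (m + 1))) 1)) with hM₁
  have hM₁0 : 0 < M₁ := by positivity
  have hM0 : 0 ≤ M := (hu0 0).trans (hM 0)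
  -- The paraboloid has height `2 * M₁ * d` with `d ≤ M`; doubling `M₁ * d` puts it strictly above
  -- `u` at a point of the half ball. `L` exceeds the distance from the far centre to any point of
  -- the ball next to `x`.
  obtain ⟨C, hC, hCint⟩ := exists_setIntegral_le_of_paraboloid hα0 hα2 hG hG0 hGL hc₀ hGm hu hu0 hK
    hF hFK hv₀ hr₀ hC₀ (κm := 2 * M₁ * (M + 1)) (by positivity) (L := 2 * Λ + 6) (by positivity)
  refine ⟨C * (2 * M₁), by positivity, fun l d x hlΛ hd0 hd hmin hx0 hdist hB => ?_⟩
  have hdM : d ≤ M := by linarith [hu0 (reflect l x), hM x]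
  have hxl : x (Fin.last m) < l := by linarith
  set z := x + (2 * l + 2 - x (Fin.last m)) • lastVec m with hz
  have hzlast : z (Fin.last m) = 2 * l + 2 := by rw [hz, add_smul_lastVec_last]; ring
  have hfar := hB.far hc₀ hp0 hu hu_ext hx0 hxl (by linarith) hmin hlΛ hδ hdist
  rw [← hz, ← hk₁] at hfar
  obtain ⟨y, hy, hy2⟩ : ∃ y ∈ Metric.ball z (1 / 2), u y ≤ M₁ * d := by
    refine exists_le_of_setIntegral_le hu hu0 ?_ hfar
    rw [hM₁, ← mul_assoc, mul_div_cancel₀ _ (by positivity), mul_div_right_comm]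
    exact mul_lt_mul_of_pos_right (lt_of_le_of_lt (le_abs_self _) (lt_add_one _)) hd0
  set q := x - (2 * ρ) • lastVec m with hq
  have hqlast : q (Fin.last m) = x (Fin.last m) - 2 * ρ := by simp [hq]
  rw [mul_assoc]
  refine hCint (2 * M₁ * d) z _ (by positivity) ?_ ?_ ⟨y, ?_, ?_⟩ measurableSet_ball ?_ ?_
  · exact mul_le_mul_of_nonneg_left (by linarith) (by positivity)
  · intro y hy
    have h1 := (abs_lt.1 (last_lt_of_mem_ball hy)).1
    simp only [upperHalfSpace, Set.mem_ofPred_eq]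
    linarith
  · exact Metric.ball_subset_ball (by norm_num) hy
  · rw [Metric.mem_ball, dist_eq_norm] at hy
    have h1 : ‖y - z‖ ^ 2 ≤ (1 / 2) ^ 2 := pow_le_pow_left₀ (norm_nonneg _) hy.le 2
    have h2 : 0 < M₁ * d := by positivity
    have h3 := mul_le_mul_of_nonneg_left h1 h2.le
    linarith
  · intro y hy
    have h1 := (abs_lt.1 (last_lt_of_mem_ball hy)).2
    have h2 := (abs_le.1 (abs_last_le (y - z))).1
    rw [PiLp.sub_apply, hzlast] at h2
    linarith
  · intro y hy
    rw [Metric.mem_ball, dist_eq_norm] at hy ⊢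
    have h1 := norm_sub_le_norm_sub_add_norm_sub y q z
    have h2 : q - z = -((2 * ρ + (2 * l + 2 - x (Fin.last m))) • lastVec m) := by
      rw [hq, hz]; module
    have h3 : ‖q - z‖ = 2 * ρ + (2 * l + 2 - x (Fin.last m)) := by
      rw [h2, norm_neg, norm_smul, norm_lastVec, mul_one, Real.norm_of_nonneg (by linarith)]
    linarith

/-- Monotonicity under reflection propagates from one level to slightly higher levels, by an amount
that is uniform on bounded ranges of levels. -/
lemma exists_reflection_step (hα0 : 0 < α)
    (hα2 : α < 2) (hG : Continuous G) (hG0 : G 0 = 0) (hGL : LipschitzOnBounded G) (hc₀ : 0 < c₀)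
    (hGm : ∀ s t, s ≤ t → c₀ * (t - s) ≤ G t - G s)
    (hu : Continuous u) (hu0 : ∀ x, 0 ≤ u x)
    (hM : ∀ x, u x ≤ M)
    (hu_ext : ∀ x ∉ upperHalfSpace m, u x = 0)
    (hu_lim : Tendsto u (cocompact (EuclideanSpace ℝ (Fin (m + 1)))) (𝓝 0))
    {h : ℝ → ℝ} (hK : 0 ≤ K) (hh : ∀ x y, |h (u x) - h (u y)| ≤ K * |u x - u y|)
    (hh0 : h 0 = 0) (hu_eq : ∀ x ∈ upperHalfSpace m, HasFAlpha G α u x (h (u x)))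
    {v₀ : EuclideanSpace ℝ (Fin (m + 1))} (hv₀ : v₀ ≠ 0) {r₀ C₀ : ℝ} (hr₀ : 0 < r₀)
    (hC₀ : ∀ ε, 0 < ε → ε ≤ r₀ → |annulusIntegral G α ε r₀ v₀| ≤ C₀) {Λ : ℝ} (hΛ : 0 < Λ) :
    ∃ η₀ : ℝ, 0 < η₀ ∧ ∀ l η : ℝ, 0 ≤ l → 0 < η → η ≤ η₀ → l + η ≤ Λ →
      (∀ y : EuclideanSpace ℝ (Fin (m + 1)), y (Fin.last m) < l → u y ≤ u (reflect l y)) →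
      ∀ y : EuclideanSpace ℝ (Fin (m + 1)), y (Fin.last m) < l + η → u y ≤ u (reflect (l + η) y) := by
  set p : ℝ := ((m + 1 : ℕ) : ℝ) + α with hp
  have hp1 : 1 ≤ p := by
    have : (1 : ℝ) ≤ ((m + 1 : ℕ) : ℝ) := by exact_mod_cast Nat.le_add_left 1 m
    linarith
  have hp0 : 0 < p := by linarith
  set V := volume.real (Metric.ball (0 : EuclideanSpace ℝ (Fin (m + 1))) 1) with hV
  have hV0 : 0 < V := volume_real_unitBall_pos
  have hCn := normConst_pos (m + 1) hα0 hα2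
  set K' := K / normConst (m + 1) α with hK'
  obtain ⟨δ₀, hδ₀, hδ₀'⟩ := exists_distance_threshold m (K := K') hα0 hc₀ hV0
  obtain ⟨ρ, hρ, hρδ, hρ1, hρK⟩ := exists_small_radius m (K := K') hα0 hc₀ hV0 hδ₀
  rw [← hp] at hρK
  set Y := 1 / 4 * ((ρ / 2) ^ (m + 1) * V) with hY
  have hY0 : 0 < Y := by positivity
  have hKlow : ∀ x ∈ upperHalfSpace m, -(K * u x) ≤ h (u x) := fun x _ => by
    have hz : u 0 = 0 := hu_ext 0 (by simp [upperHalfSpace])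
    have h1 := hh x 0
    rw [hz, hh0, sub_zero, sub_zero, abs_of_nonneg (hu0 x)] at h1
    exact (abs_le.1 h1).1
  obtain ⟨C, hC, hCint⟩ := exists_setIntegral_le_at_reflection_min hα0 hα2 hG hG0 hGL hc₀ hGm hu hu0
    hM hu_ext hK hu_eq hKlow hv₀ hr₀ hC₀ hΛ hδ₀ hρ hρ1 K'
  -- This choice makes `2 * η / ρ * C ≤ Y / 2`, contradicting `Y * d ≤ 2 * η / ρ * (C * d)`. None of
  -- the constants depends on `l`.
  refine ⟨ρ * Y / (4 * C), by positivity, fun l η hl hη hηη hlΛ hmono => ?_⟩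
  by_contra! hcon
  obtain ⟨y', hy', hy'lt⟩ := hcon
  obtain ⟨x, hxl, hneg, hmin⟩ := exists_reflection_min hu hu_lim hy' hy'lt
  obtain ⟨d, hd⟩ : ∃ d, d = u x - u (reflect (l + η) x) := ⟨_, rfl⟩
  have hd0 : 0 < d := by linarith
  have hxΩ : x ∈ upperHalfSpace m := by
    by_contra hx
    rw [hu_ext x hx] at hneg
    linarith [hu0 (reflect (l + η) x)]
  have hRΩ : reflect (l + η) x ∈ upperHalfSpace m := by
    simp only [upperHalfSpace, Set.mem_ofPred_eq, reflect_last]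
    linarith
  have hB : ReflectionBound c₀ p (l + η) u x (K' * d) := by
    intro S g r hS hSl hr hSr hg hgle
    refine (setIntegral_le_of_reflection_min hα0 hα2 hc₀ hGm hxl (hu_eq x hxΩ) (hu_eq _ hRΩ) hmin
      hneg.le hS hSl hr hSr hg hgle).trans ?_
    rw [hK', div_mul_eq_mul_div]
    refine div_le_div_of_nonneg_right ?_ hCn.le
    have h1 := (le_abs_self _).trans (hh x (reflect (l + η) x))
    rwa [← hd, abs_of_pos hd0] at h1
  have hdist : δ₀ ≤ (l + η) - x (Fin.last m) := by
    by_contra! hlt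
    have h1 := hδ₀' _ (by linarith) hlt
    have h2 := hB.distance hc₀ hp0 hxl hneg hmin
    rw [← hd] at h2
    have h3 := mul_lt_mul_of_pos_right h1 hd0
    linarith
  have hmass := hCint (l + η) d x hlΛ hd0 hd hmin hxΩ hdist hB
  have hnear := hB.near hc₀ hp1 hu hxl hneg hmin hρ (hρδ.trans hdist)
  have hqlast : (x - (2 * ρ) • lastVec m) (Fin.last m) = x (Fin.last m) - 2 * ρ := by simp
  have hsub : ∀ y, u (reflect (l + η) y) - u y - (u (reflect (l + η) x) - u x)
      = u (reflect (l + η) y) - u y + d := fun y => by rw [hd]; ring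
  have hlast : ∀ y ∈ Metric.ball (x - (2 * ρ) • lastVec m) ρ, y (Fin.last m) < l + η :=
    fun y hy => by
      have h1 := (abs_lt.1 (last_lt_of_mem_ball hy)).2
      linarith
  have hdrop : Y * d ≤ 2 * η / ρ *
      ∫ y in Metric.ball (x - (2 * ρ) • lastVec m) (2 * ρ), u y := mul_le_of_average_near_min hu hu0 hη hρ hd0.le hmono hlast
    (fun y hy => by linarith [hmin y (hlast y hy)]) (by
      simp only [hsub] at hnear
      refine hnear.trans ?_
      rw [mul_div_right_comm]
      exact mul_le_mul_of_nonneg_right hρK hd0.le)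
  have h1 : 2 * η / ρ * ∫ y in Metric.ball (x - (2 * ρ) • lastVec m) (2 * ρ), u y
      ≤ 2 * η / ρ * (C * d) := mul_le_mul_of_nonneg_left hmass (by positivity)
  have h2 : 2 * η / ρ * (C * d) ≤ Y / 2 * d := by
    rw [le_div_iff₀ (by positivity)] at hηη
    rw [div_mul_eq_mul_div, div_le_iff₀ hρ]
    have h3 := mul_le_mul_of_nonneg_right hηη hd0.le
    linarith
  have h3 : 0 < Y * d := by positivity
  linarith

end Step

/-! ### Reaching every level, and passing to infinity. -/

/-- Monotonicity under all reflections in horizontal levels, together with decay at infinity. -/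
lemma eq_zero_of_reflection_step {m : ℕ} {u : EuclideanSpace ℝ (Fin (m + 1)) → ℝ}
    (hu0 : ∀ x, 0 ≤ u x) (hu_ext : ∀ x ∉ upperHalfSpace m, u x = 0)
    (hu_lim : Tendsto u (cocompact (EuclideanSpace ℝ (Fin (m + 1)))) (𝓝 0))
    (hstep : ∀ Λ : ℝ, 0 < Λ → ∃ η₀ : ℝ, 0 < η₀ ∧ ∀ l η : ℝ, 0 ≤ l → 0 < η → η ≤ η₀ → l + η ≤ Λ →
      (∀ y : EuclideanSpace ℝ (Fin (m + 1)), y (Fin.last m) < l → u y ≤ u (reflect l y)) →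
      ∀ y : EuclideanSpace ℝ (Fin (m + 1)), y (Fin.last m) < l + η →
        u y ≤ u (reflect (l + η) y)) (x : EuclideanSpace ℝ (Fin (m + 1))) : u x = 0 := by
  have hall : ∀ Λ : ℝ, 0 < Λ → ∀ y : EuclideanSpace ℝ (Fin (m + 1)), y (Fin.last m) < Λ →
      u y ≤ u (reflect Λ y) := by
    intro Λ hΛ
    obtain ⟨η₀, hη₀, hη⟩ := hstep Λ hΛ
    -- The step `η₀` is uniform up to `Λ`, so `N` steps of length `Λ / N ≤ η₀` starting from level
    -- zero suffice.
    obtain ⟨N, hN⟩ := exists_nat_gt (Λ / η₀)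
    have hN0 : (0 : ℝ) < N := (by positivity : 0 < Λ / η₀).trans hN
    have hle : Λ / N ≤ η₀ := by
      rw [div_lt_iff₀ hη₀] at hN
      rw [div_le_iff₀ hN0]
      linarith
    have hind : ∀ k : ℕ, k ≤ N → ∀ y : EuclideanSpace ℝ (Fin (m + 1)),
        y (Fin.last m) < k * (Λ / N) → u y ≤ u (reflect (k * (Λ / N)) y) := by
      intro k
      induction k with
      | zero =>
        intro _ y hy
        rw [Nat.cast_zero, zero_mul] at hy
        rw [hu_ext y fun h => (not_lt.2 hy.le) h]
        exact hu0 _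
      | succ k ih =>
        intro hk
        have e : ((k + 1 : ℕ) : ℝ) * (Λ / N) = k * (Λ / N) + Λ / N := by push_cast; ring
        rw [e]
        refine hη _ _ (by positivity) (by positivity) hle ?_ (ih (by omega))
        rw [← e, mul_div_assoc', div_le_iff₀ hN0, mul_comm]
        exact mul_le_mul_of_nonneg_left (by exact_mod_cast hk) hΛ.le
    have h1 := hind N le_rfl
    rwa [mul_div_cancel₀ _ hN0.ne'] at h1
  have hlim : Tendsto (fun Λ : ℝ => u (reflect Λ x)) atTop (𝓝 0) := by
    refine hu_lim.comp ?_
    rw [← Metric.cobounded_eq_cocompact, ← tendsto_norm_atTop_iff_cobounded]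
    refine tendsto_atTop_mono' (f₁ := fun Λ : ℝ => 2 * Λ - x (Fin.last m)) _
      (Eventually.of_forall fun Λ => ?_) ?_
    · have := abs_last_le (reflect Λ x)
      rw [reflect_last] at this
      exact (le_abs_self _).trans this
    · exact tendsto_atTop_add_const_right _ _ (tendsto_id.const_mul_atTop two_pos)
  refine le_antisymm (ge_of_tendsto hlim ?_) (hu0 x)
  filter_upwards [eventually_gt_atTop 0, eventually_gt_atTop (x (Fin.last m))] with Λ h1 h2
  exact hall Λ h1 x h2

/-! ### Taylor bound, the case of vanishing gradient, and the conclusion. -/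

/-- The second order Taylor bound at a point of the open set where `u` is `C^{1,1}_loc`. -/
lemma IsC11LocOn.exists_taylor_bound {n : ℕ} {u : EuclideanSpace ℝ (Fin n) → ℝ}
    {Ω : Set (EuclideanSpace ℝ (Fin n))} (hΩ : IsOpen Ω) (hu : IsC11LocOn u Ω)
    {x : EuclideanSpace ℝ (Fin n)} (hx : x ∈ Ω) :
    ∃ L r : ℝ, 0 < r ∧ ∀ z ∈ Metric.ball (0 : EuclideanSpace ℝ (Fin n)) r,
      |u (x + z) - u x - fderiv ℝ u x z| ≤ L * ‖z‖ ^ 2 := by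
  obtain ⟨L, t, ht, hL⟩ := hu.2 hx
  rw [hΩ.nhdsWithin_eq hx] at ht
  obtain ⟨r, hr, hrt⟩ := Metric.mem_nhds_iff.1 (inter_mem ht (hΩ.mem_nhds hx))
  refine ⟨L, r, hr, fun z hz => ?_⟩
  have hzr : ‖z‖ < r := by simpa using hz
  have hsub : ∀ y ∈ Metric.closedBall x ‖z‖, y ∈ t ∩ Ω := fun y hy =>
    hrt (Metric.closedBall_subset_ball hzr hy)
  have key := (convex_closedBall x ‖z‖).norm_image_sub_le_of_norm_fderiv_le' (f := u)
    (φ := fderiv ℝ u x) (C := L * ‖z‖) (x := x) (y := x + z)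
    (fun y hy => (hu.1 y (hsub y hy).2).differentiableAt (hΩ.mem_nhds (hsub y hy).2))
    (fun y hy => by
      have h1 := hL.dist_le_mul y (hsub y hy).1 x (mem_of_mem_nhds ht)
      rw [dist_eq_norm] at h1
      exact h1.trans (mul_le_mul_of_nonneg_left (Metric.mem_closedBall.1 hy) L.2))
    (Metric.mem_closedBall_self (norm_nonneg z)) (by simp)
  rw [add_sub_cancel_left, Real.norm_eq_abs] at key
  refine key.trans (le_of_eq ?_)
  ring

lemma isOpen_upperHalfSpace (m : ℕ) : IsOpen (upperHalfSpace m) :=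
  isOpen_lt continuous_const continuous_last

lemma convex_upperHalfSpace (m : ℕ) : Convex ℝ (upperHalfSpace m) := by
  intro x hx y hy a b ha hb hab
  have hx' : 0 < x (Fin.last m) := hx
  have hy' : 0 < y (Fin.last m) := hy
  simp only [upperHalfSpace, Set.mem_ofPred_eq, PiLp.add_apply, PiLp.smul_apply, smul_eq_mul]
  rcases ha.eq_or_lt with rfl | ha
  · have : b = 1 := by linarith
    simpa [this] using hy'
  · have := mul_pos ha hx'
    have := mul_nonneg hb hy'.le
    linarith

/-- A function that decays at infinity and has vanishing gradient in the half space vanishes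
there. -/
lemma eq_zero_of_fderiv_eq_zero {m : ℕ} {u : EuclideanSpace ℝ (Fin (m + 1)) → ℝ}
    (hu : DifferentiableOn ℝ u (upperHalfSpace m))
    (hu_lim : Tendsto u (cocompact (EuclideanSpace ℝ (Fin (m + 1)))) (𝓝 0))
    (hfd : ∀ x ∈ upperHalfSpace m, fderiv ℝ u x = 0) {x : EuclideanSpace ℝ (Fin (m + 1))}
    (hx : x ∈ upperHalfSpace m) : u x = 0 := by
  have hx' : 0 < x (Fin.last m) := hx
  have hmem : ∀ t : ℝ, 0 ≤ t → x + t • lastVec m ∈ upperHalfSpace m := fun t ht => by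
    simp only [upperHalfSpace, Set.mem_ofPred_eq, add_smul_lastVec_last]
    linarith
  have hconst : ∀ t : ℝ, 0 ≤ t → u (x + t • lastVec m) = u x := fun t ht =>
    (convex_upperHalfSpace m).is_const_of_fderivWithin_eq_zero hu
      (fun y hy => by rw [fderivWithin_of_isOpen (isOpen_upperHalfSpace m) hy, hfd y hy])
      (hmem t ht) hx
  have hlim : Tendsto (fun t : ℝ => u (x + t • lastVec m)) atTop (𝓝 0) := by
    refine hu_lim.comp ?_
    rw [← Metric.cobounded_eq_cocompact, ← tendsto_norm_atTop_iff_cobounded]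
    refine tendsto_atTop_mono' (f₁ := fun t : ℝ => x (Fin.last m) + t) _
      (Eventually.of_forall fun t => ?_) (tendsto_atTop_add_const_left _ _ tendsto_id)
    have := abs_last_le (x + t • lastVec m)
    rw [add_smul_lastVec_last] at this
    exact (le_abs_self _).trans this
  refine tendsto_nhds_unique (tendsto_const_nhds.congr' ?_) hlim
  filter_upwards [eventually_ge_atTop 0] with t ht
  exact (hconst t ht).symm

end HalfSpaceLiouville

theorem theorem3p3 (m : ℕ) (α : ℝ) (hα0 : 0 < α) (hα2 : α < 2)
    (G : ℝ → ℝ) (hG : ContDiff ℝ 1 G) (hG0 : G 0 = 0)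
    (c₀ : ℝ) (hc₀ : 0 < c₀) (hG' : ∀ t : ℝ, c₀ ≤ deriv G t)
    (h : ℝ → ℝ) (u : EuclideanSpace ℝ (Fin (m + 1)) → ℝ)
    (hu_L : HalfSpaceLiouville.MemLAlpha α u)
    (hu_reg : HalfSpaceLiouville.IsC11LocOn u (HalfSpaceLiouville.upperHalfSpace m))
    (hu_cont : Continuous u)
    (hu_nonneg : ∀ x, 0 ≤ u x)
    (hu_eq : ∀ x ∈ HalfSpaceLiouville.upperHalfSpace m,
      HalfSpaceLiouville.HasFAlpha G α u x (h (u x)))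
    (hu_ext : ∀ x ∉ HalfSpaceLiouville.upperHalfSpace m, u x = 0)
    (hu_lim : Tendsto u (cocompact (EuclideanSpace ℝ (Fin (m + 1)))) (𝓝 0))
    (hh_lip : ∃ K : NNReal, LipschitzOnWith K h (Set.range u))
    (hh0 : h 0 = 0) :
    ∀ x, u x = 0 := by
  open HalfSpaceLiouville in
  intro x
  -- A point of nonzero gradient is needed to control the operator on linear functions; without one,
  -- `u` is constant in the half space.
  by_cases hfd : ∀ y ∈ upperHalfSpace m, fderiv ℝ u y = 0
  · by_cases hx : x ∈ upperHalfSpace m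
    · exact eq_zero_of_fderiv_eq_zero hu_reg.1 hu_lim hfd hx
    · exact hu_ext x hx
  push Not at hfd
  obtain ⟨y, hy, hfy⟩ := hfd
  have hGm : ∀ s t, s ≤ t → c₀ * (t - s) ≤ G t - G s := fun s t hst =>
    mul_sub_le_image_sub_of_le_deriv (hG.differentiable one_ne_zero) hG' hst
  have hGL := lipschitzOnBounded_of_contDiff hG
  obtain ⟨M, hM⟩ : ∃ M, ∀ z, u z ≤ M := by
    obtain ⟨t, ht, htu⟩ := mem_cocompact.1 (hu_lim.eventually (gt_mem_nhds one_pos))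
    obtain ⟨M, hM⟩ := ht.exists_bound_of_continuousOn hu_cont.continuousOn
    refine ⟨max M 1, fun z => ?_⟩
    by_cases hz : z ∈ t
    · exact ((le_abs_self _).trans (hM z hz)).trans (le_max_left _ _)
    · have hz1 : u z < 1 := htu hz
      exact hz1.le.trans (le_max_right _ _)
  obtain ⟨K, hK⟩ := hh_lip
  have hh : ∀ y z, |h (u y) - h (u z)| ≤ K * |u y - u z| := fun y z => by
    simpa [Real.dist_eq] using
      hK.dist_le_mul (u y) (Set.mem_range_self y) (u z) (Set.mem_range_self z)
  -- The operator acts on increments `u x - u z`, so the relevant linear part is minus the gradient.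
  set v : EuclideanSpace ℝ (Fin (m + 1)) :=
    -(InnerProductSpace.toDual ℝ (EuclideanSpace ℝ (Fin (m + 1)))).symm (fderiv ℝ u y) with hv
  have hv0 : v ≠ 0 := by simpa [hv] using hfy
  obtain ⟨L, r₁, hr₁, hT⟩ := hu_reg.exists_taylor_bound (isOpen_upperHalfSpace m) hy
  obtain ⟨r₀, C₀, hr₀, hC₀⟩ := annulusIntegral_bounded hα0 hα2 hG.continuous hGL hu_cont (M := M)
    (fun z => by rw [abs_of_nonneg (hu_nonneg z)]; exact hM z) (v := v) hr₁ (hu_eq y hy)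
    (L := L) fun z hz => by
      have e : inner ℝ v z = -(fderiv ℝ u y z) := by
        rw [hv, inner_neg_left, InnerProductSpace.toDual_symm_apply]
      rw [e]
      refine le_trans (le_of_eq ?_) (hT z hz)
      congr 1
      ring
  exact eq_zero_of_reflection_step hu_nonneg hu_ext hu_lim (fun Λ hΛ =>
    exists_reflection_step hα0 hα2 hG.continuous hG0 hGL hc₀ hGm hu_cont hu_nonneg hM hu_ext hu_lim
      K.2 hh hh0 hu_eq hv0 hr₀ hC₀ hΛ) x
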